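/- Let $N,n\in\mathbb Z_{>0}$ and let $\mathbb C^N$ have the standard basis $v_1,\dots,v_N$ and matrix units $e_{i,j}$. For a partition $I=(I_1,\dots,I_N)$ of $\{1,\dots,n\}$ into disjoint (possibly empty) subsets let $v_I=v_{i_1}\otimes\dots\otimes v_{i_n}$, where $i_a=m$ if $a\in I_m$; the vectors $v_I$ form a basis of $(\mathbb C^N)^{\otimes n}$. A superscript $(a)$ or $(a,b)$ indicates the tensor factors on which an operator acts. Let $P$ be the permutation of the factors of $\mathbb C^N\otimes\mathbb C^N$ and $$R^\circ(u)=P+u\sum_{1\le i<j\le N}e_{i,i}\otimes e_{j,j}.$$ For $z\in\mathbb C^n$, $p\in\mathbb C^N$, $\kappa\in\mathbb C$, $a=1,\dots,n$, set $$K^\circ_a(z;p;\kappa)=R^\circ(z_a-z_{a-1}+\kappa)^{(a,a-1)}\cdots R^\circ(z_a-z_1+\kappa)^{(a,1)}\;p_1^{e^{(a)}_{1,1}}\cdots p_N^{e^{(a)}_{N,N}}\;R^\circ(z_a-z_n)^{(a,n)}\cdots R^\circ(z_a-z_{a+1})^{(a,a+1)},$$ where $p_1^{e^{(a)}_{1,1}}\cdots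 p_N^{e^{(a)}_{N,N}}$ multiplies $v_I$ by $p_i$ if $a\in I_i$. For $I$ as above let $\lambda_i=|I_i|$, let $I^{\min}$ be the partition whose first block consists of the first $\lambda_1$ elements of $\{1,\dots,n\}$, whose second block consists of the next $\lambda_2$ elements, and so on, and let $|\sigma_I|$ be the minimal length of a permutation $\sigma\in S_n$ with $\sigma(I^{\min})=I$. Let $s_{a,b}$ be the transposition of $a$ and $b$. For $a\in I_i$, $b\in I_j$, $i\ne j$, call the pair $(a,b)$ $I$-admissible if either $|\sigma_{s_{a,b}(I)}|=|\sigma_I|-1$ or $|\sigma_{s_{a,b}(I)}|=|\sigma_I|+m_{a,b,I}-1$, where $m_{a,b,I}=\sum_{r=k}^{l-1}(\lambda_r+\lambda_{r+1})$, $k=\min(i,j)$, $l=\max(i,j)$. For $i\neq j$ let $Q^{a,b}_{i,j}v_I=v_{s_{a,b}(I)}$ if $a\in I_i$, $b\in I_j$ and $(a,b)$ is $I$-admissible, and $Q^{a,b}_{i,j}v_I=0$ otherwise. If all $p_i\ne0$, set for $i=1,\dots,N$ $$X^\circ_i(z;p)=\sum_{a=1}^n z_a e^{(a)}_{i,i}+\sum_{1\le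 b<a\le n}\Bigl(\sum_{j=i+1}^N Q^{a,b}_{i,j}-\sum_{j=1}^{i-1}\frac{p_i}{p_j}Q^{a,b}_{i,j}\Bigr)+\sum_{1\le a<b\le n}\Bigl(\sum_{j=i+1}^N\frac{p_j}{p_i}Q^{a,b}_{i,j}-\sum_{j=1}^{i-1}Q^{a,b}_{i,j}\Bigr).$$ Consider, for $(\mathbb C^N)^{\otimes n}$-valued functions $f(z,p)$, the differential operators $\nabla^\circ_i=\kappa p_i\frac{\partial}{\partial p_i}-X^\circ_i(z;p)$, $i=1,\dots,N$, and the difference operators $$(Z_af)(z,p)=K^\circ_a(z_1,\dots,z_a-\kappa,\dots,z_n;p;\kappa)\,f(z_1,\dots,z_a-\kappa,\dots,z_n,p),\qquad a=1,\dots,n.$$ Thus $\nabla^\circ_if=0$ are the limiting dynamical equations $\kappa p_i\frac{\partial f}{\partial p_i}=X^\circ_i(z;p)f$, and $Z_af=f$ are the limiting qKZ equations $f(z_1,\dots,z_a+\kappa,\dots,z_n,p)=K^\circ_a(z;p;\kappa)f(z,p)$. Then, for every $\kappa\in\mathbb C$, the joint system of these equations is compatible: on functions that are holomorphic in $p$ on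 an open subset of $\{p\in\mathbb C^N: p_1\cdots p_N\neq0\}$ the operators $\nabla^\circ_1,\dots,\nabla^\circ_N,Z_1,\dots,Z_n$ pairwise commute. In particular, the operators $\nabla^\circ_i$ pairwise commute. Moreover, for all $p\in\mathbb C^N$ the operators $K^\circ_a$ form a discrete flat connection: $$K^\circ_a(z_1,\dots,z_b+\kappa,\dots,z_n;p;\kappa)\,K^\circ_b(z;p;\kappa)=K^\circ_b(z_1,\dots,z_a+\kappa,\dots,z_n;p;\kappa)\,K^\circ_a(z;p;\kappa)$$ for all $a,b=1,\dots,n$ and $z\in\mathbb C^n$. -/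

import Mathlib

open scoped Matrix Kronecker

noncomputable section

namespace LimitQKZ

/-- `Config N n` indexes the standard basis `v_I` of `(ℂ^N)^{⊗n}`.  The ordered set partition
`I = (I_1, …, I_N)` of the set of `n` positions is the map `I` with `I a = i` iff `a ∈ I_i`,
so that `v_I = v_{I 0} ⊗ ⋯ ⊗ v_{I (n-1)}`. -/
abbrev Config (N n : ℕ) : Type := Fin n → Fin N

/-- The space `(ℂ^N)^{⊗n}` in coordinates with respect to the basis `(v_I)`. -/
abbrev TSpace (N n : ℕ) : Type := Config N n → ℂ

/-- Linear operators on `(ℂ^N)^{⊗n}`, as matrices in the basis `(v_I)`: the column with index `I`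
is the image of `v_I`. -/
abbrev TOp (N n : ℕ) : Type := Matrix (Config N n) (Config N n) ℂ

/-- `A^{(a)}`: the operator `A` on `ℂ^N` acting on the `a`-th tensor factor. -/
def actOne {N n : ℕ} (a : Fin n) (A : Matrix (Fin N) (Fin N) ℂ) : TOp N n :=
  Matrix.of fun J I => if ∀ c, c ≠ a → J c = I c then A (J a) (I a) else 0

/-- `A^{(a,b)}` for `a ≠ b`: the operator `A` on `ℂ^N ⊗ ℂ^N` acting on the tensor factors `a`
(through the first factor of `A`) and `b` (through the second factor of `A`). -/
def actTwo {N n : ℕ} (a b : Fin n) (A : Matrix (Fin N × Fin N) (Fin N × Fin N) ℂ) : TOp N n :=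
  Matrix.of fun J I =>
    if ∀ c, c ≠ a → c ≠ b → J c = I c then A (J a, J b) (I a, I b) else 0

/-- The matrix unit `e_{i,j}` on `ℂ^N`, `e_{i,j} v_j = v_i`. -/
def matUnit {N : ℕ} (i j : Fin N) : Matrix (Fin N) (Fin N) ℂ := Matrix.single i j 1

/-- The permutation of the factors of `ℂ^N ⊗ ℂ^N`. -/
def flipOp (N : ℕ) : Matrix (Fin N × Fin N) (Fin N × Fin N) ℂ :=
  Matrix.of fun x y => if x = y.swap then 1 else 0

/-- The limiting `R`-matrix `R°(u) = P + u ∑_{i<j} e_{i,i} ⊗ e_{j,j}`. -/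
def Rlim (N : ℕ) (u : ℂ) : Matrix (Fin N × Fin N) (Fin N × Fin N) ℂ :=
  flipOp N + u • ∑ i : Fin N, ∑ j ∈ Finset.Ioi i, (matUnit i i) ⊗ₖ (matUnit j j)

/-- The operator `p_1^{e_{1,1}^{(a)}} ⋯ p_N^{e_{N,N}^{(a)}}`: it multiplies by `p_i` the vectors
that have `v_i` at the `a`-th tensor factor. -/
def pPow {N n : ℕ} (a : Fin n) (p : Fin N → ℂ) : TOp N n := actOne a (Matrix.diagonal p)

/-- The limiting qKZ operator
`K°_a(z; p; κ) = R°(z_a - z_{a-1} + κ)^{(a,a-1)} ⋯ R°(z_a - z_1 + κ)^{(a,1)}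
  · p_1^{e_{1,1}^{(a)}} ⋯ p_N^{e_{N,N}^{(a)}}
  · R°(z_a - z_n)^{(a,n)} ⋯ R°(z_a - z_{a+1})^{(a,a+1)}`. -/
def Klim {N n : ℕ} (κ : ℂ) (a : Fin n) (z : Fin n → ℂ) (p : Fin N → ℂ) : TOp N n :=
  (((List.finRange n).reverse.filter (fun b => b < a)).map
      (fun b => actTwo a b (Rlim N (z a - z b + κ)))).prod
    * pPow a p
    * (((List.finRange n).reverse.filter (fun b => a < b)).map
      (fun b => actTwo a b (Rlim N (z a - z b)))).prod

/-- The length of a permutation: its number of inversions. -/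
def permLength {n : ℕ} (σ : Equiv.Perm (Fin n)) : ℕ :=
  ((Finset.univ : Finset (Fin n × Fin n)).filter (fun x => x.1 < x.2 ∧ σ x.2 < σ x.1)).card

/-- The `i`-th block `I_i` of `I`. -/
def block {N n : ℕ} (I : Config N n) (i : Fin N) : Finset (Fin n) :=
  Finset.univ.filter (fun a => I a = i)

/-- The weight `λ_i = |I_i|`. -/
def weight {N n : ℕ} (I : Config N n) (i : Fin N) : ℕ := (block I i).card

/-- The `i`-th block of `I^min_λ`, where `λ` is the weight of `I`: the first `λ_1` positions form
the first block, the next `λ_2` positions the second one, and so on. -/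
def minBlock {N n : ℕ} (I : Config N n) (i : Fin N) : Finset (Fin n) :=
  Finset.univ.filter (fun a : Fin n =>
    ∑ j ∈ Finset.Iio i, weight I j ≤ (a : ℕ) ∧ (a : ℕ) < ∑ j ∈ Finset.Iic i, weight I j)

/-- `|σ_I|`: the minimal length of a permutation `σ` such that `σ(I^min_λ) = I`. -/
def len {N n : ℕ} (I : Config N n) : ℕ :=
  sInf {l : ℕ | ∃ σ : Equiv.Perm (Fin n),
    (∀ i, (minBlock I i).map σ.toEmbedding = block I i) ∧ permLength σ = l}

/-- `s_{a,b}(I)`: the positions `a` and `b` exchange the blocks to which they belong. -/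
def swapAt {N n : ℕ} (a b : Fin n) (I : Config N n) : Config N n := I ∘ Equiv.swap a b

/-- `m_{a,b,I} = ∑_{r=k}^{l-1} (λ_r + λ_{r+1}) = λ_k + λ_l + 2 ∑_{k<r<l} λ_r`, where
`k = min(i,j)`, `l = max(i,j)` for `a ∈ I_i`, `b ∈ I_j`, `i ≠ j`. -/
def mNum {N n : ℕ} (a b : Fin n) (I : Config N n) : ℕ :=
  weight I (I a) + weight I (I b)
    + 2 * ∑ r ∈ Finset.Ioo (min (I a) (I b)) (max (I a) (I b)), weight I r

/-- The pair `(a,b)` is `I`-admissible of the first kind: `|σ_{s_{a,b}(I)}| = |σ_I| - 1`. -/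
def AdmissibleFirst {N n : ℕ} (a b : Fin n) (I : Config N n) : Prop :=
  (len (swapAt a b I) : ℤ) = (len I : ℤ) - 1

/-- The pair `(a,b)` is `I`-admissible of the second kind:
`|σ_{s_{a,b}(I)}| = |σ_I| + m_{a,b,I} - 1`, where `a` and `b` lie in distinct blocks of `I`. -/
def AdmissibleSecond {N n : ℕ} (a b : Fin n) (I : Config N n) : Prop :=
  I a ≠ I b ∧ (len (swapAt a b I) : ℤ) = (len I : ℤ) + (mNum a b I : ℤ) - 1

open Classical in
/-- The operator `Q_{i,j}^{a,b}`: it sends `v_I` to `v_{s_{a,b}(I)}` if `a ∈ I_i`, `b ∈ I_j` and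
the pair `(a,b)` is `I`-admissible of the first or the second kind, and to `0` otherwise. -/
def Qop {N n : ℕ} (i j : Fin N) (a b : Fin n) : TOp N n :=
  Matrix.of fun J I =>
    if I a = i ∧ I b = j ∧ (AdmissibleFirst a b I ∨ AdmissibleSecond a b I) ∧ J = swapAt a b I
    then 1 else 0

/-- The limiting dynamical operator `X°_i(z; p)`. -/
def Xlim {N n : ℕ} (i : Fin N) (z : Fin n → ℂ) (p : Fin N → ℂ) : TOp N n :=
  (∑ a : Fin n, z a • actOne a (matUnit i i))
    + (∑ a : Fin n, ∑ b ∈ Finset.Iio a,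
        ((∑ j ∈ Finset.Ioi i, Qop i j a b) - ∑ j ∈ Finset.Iio i, (p i / p j) • Qop i j a b))
    + ∑ a : Fin n, ∑ b ∈ Finset.Ioi a,
        ((∑ j ∈ Finset.Ioi i, (p j / p i) • Qop i j a b) - ∑ j ∈ Finset.Iio i, Qop i j a b)

/-- The point `(z_1, …, z_a + κ, …, z_n)`. -/
def shift {n : ℕ} (κ : ℂ) (a : Fin n) (z : Fin n → ℂ) : Fin n → ℂ :=
  Function.update z a (z a + κ)

/-- Functions of `z` and `p` with values in `(ℂ^N)^{⊗n}`. -/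
abbrev TFun (N n : ℕ) : Type := (Fin n → ℂ) → (Fin N → ℂ) → TSpace N n

/-- The limiting difference operator
`(Z_a f)(z, p) = K°_a(z_1, …, z_a - κ, …, z_n; p; κ) f(z_1, …, z_a - κ, …, z_n, p)`.
The equation `Z_a f = f` is the limiting qKZ equation
`f(z_1, …, z_a + κ, …, z_n, p) = K°_a(z; p; κ) f(z, p)`. -/
def qkzOp {N n : ℕ} (κ : ℂ) (a : Fin n) (f : TFun N n) : TFun N n :=
  fun z p => Klim κ a (shift (-κ) a z) p *ᵥ f (shift (-κ) a z) p

/-- The limiting differential operator `∇°_i = κ p_i ∂/∂p_i - X°_i(z; p)`.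
The equation `∇°_i f = 0` is the limiting dynamical equation. -/
def nablaLim {N n : ℕ} (κ : ℂ) (i : Fin N) (f : TFun N n) : TFun N n :=
  fun z p => (κ * p i) • fderiv ℂ (f z) p (Pi.single i 1) - Xlim i z p *ᵥ f z p

/-- The domain `p_1, …, p_N ≠ 0` of the parameters `p`. -/
def pDomain (N : ℕ) : Set (Fin N → ℂ) := {p | ∀ i, p i ≠ 0}

/-- `f(z, p)` is holomorphic in `p ∈ U` for every `z`. -/
def HolomorphicIn {N n : ℕ} (U : Set (Fin N → ℂ)) (f : TFun N n) : Prop :=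
  ∀ z, AnalyticOnNhd ℂ (f z) U

/-- Two operators on functions commute over `pDomain`: `A (B f) = B (A f)` on `U` for every local
section `f`, that is, for every open `U` where all `p_i ≠ 0` and every `f` holomorphic in
`p ∈ U`. -/
def CommuteOnSections {N n : ℕ} (A B : TFun N n → TFun N n) : Prop :=
  ∀ U : Set (Fin N → ℂ), IsOpen U → U ⊆ pDomain N → ∀ f : TFun N n, HolomorphicIn U f →
    ∀ z : Fin n → ℂ, ∀ p ∈ U, A (B f) z p = B (A f) z p

/-- The operators `K_1, …, K_n` define a discrete flat connection with step `κ`: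
`K_a(z_1, …, z_b + κ, …, z_n) K_b(z) = K_b(z_1, …, z_a + κ, …, z_n) K_a(z)`. -/
def IsDiscreteFlatConnection {N n : ℕ} (κ : ℂ) (K : Fin n → (Fin n → ℂ) → TOp N n) : Prop :=
  ∀ (a b : Fin n) (z : Fin n → ℂ), K a (shift κ b z) * K b z = K b (shift κ a z) * K a z

/-- The joint system of the limiting dynamical equations `∇°_i f = 0` and the limiting qKZ
equations `Z_a f = f` with the same parameter `κ` is compatible: all the operators `∇°_i`, `Z_a`
commute with each other. -/
def JointSystemCompatible (N n : ℕ) (κ : ℂ) : Prop :=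
  (∀ a b : Fin n, CommuteOnSections (qkzOp (N := N) κ a) (qkzOp κ b)) ∧
  (∀ i j : Fin N, CommuteOnSections (nablaLim (n := n) κ i) (nablaLim κ j)) ∧
  (∀ (i : Fin N) (a : Fin n), CommuteOnSections (nablaLim κ i) (qkzOp κ a))

end LimitQKZ

end

/-! The argument realises the system inside an affine nil-Coxeter picture. Let T be the operator
`nilOp` of two adjacent positions: it turns an ascent of labels into a descent and kills everything
else. The T's satisfy T² = 0 and the braid relations, so the operators 1 + uT (`braidOp`) satisfy
inversion and the Yang–Baxter equation. A second generator is the cyclic rotation of the factors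
twisted by p (`rotOp`).

qKZ side. Up to a permutation of factors R°(u) is 1 + uT. Hence K°_1 is the rotation times a product
of braid operators (`Klim_zero`), and K°_{a+1} is obtained from K°_a by multiplying with braid
operators on both sides (`Klim_succ`). On functions of z, with the variables permuted along, these
become relations of the extended affine symmetric group, in which the Z_a are the translations.
Translations commute (`commute_translations`). The proof never inverts the rotation, so zeros among
the p_i are allowed, and flatness of K° follows.

Dynamical side. By a length count, a pair is admissible exactly when no label of the closed interval
spanned by the two labels lies on the cyclic arc from the larger label to the smaller one
(`admissible_iff`). Thus X°_i = D_i(z) + E_i, where D_i is diagonal and linear in z and E_i is a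
signed sum of cyclic "hops", those crossing the right end carrying p_j/p_i. Three facts carry the
proof: [T, E_i] = e_i^{(a')} - e_i^{(a)} (`nilOp_exchSum`), E_i commutes with the rotation
(`rotOp_commute_exchSum`), and [e_i^{(a)}, E_k] is symmetric in i, k (`eOp_exchSum`). They imply
that [E_i, E_k] commutes with all T's and with the rotation; as it preserves weights and has zero
diagonal, it vanishes (`eq_zero_of_commute`), because weakly decreasing words generate each weight
space under T and rotation. So the X°_i commute, and since p_k ∂X°_i/∂p_k is symmetric in i ≠ k, so
do the ∇°_i, for every κ.

Mixed relations. X°_i commutes with the braid operators acting on functions, and its commutator with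
the rotation comes only from the shift by κ in one variable. Hence [X°_i, Z_a] = κ p_i ∂Z_a/∂p_i
(`dynFun_qkzFun`; K° is linear in p), which is [∇°_i, Z_a] = 0. -/

noncomputable section

namespace LimitQKZ

/-! ### Weighted permutation operators -/

section Mono

variable {N n : ℕ}

/-- The weighted permutation operator `(mono σ w f)_J = w J * f_{J ∘ σ}`. -/
def mono (σ : Equiv.Perm (Fin n)) (w : Config N n → ℂ) : TOp N n :=
  Matrix.of fun J I => if I = J ∘ σ then w J else 0

lemma mono_apply (σ : Equiv.Perm (Fin n)) (w : Config N n → ℂ) (J I : Config N n) :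
    mono σ w J I = if I = J ∘ σ then w J else 0 := rfl

lemma mono_mul_apply (σ : Equiv.Perm (Fin n)) (w : Config N n → ℂ) (B : TOp N n)
    (J I : Config N n) : (mono σ w * B) J I = w J * B (J ∘ σ) I := by
  simp [Matrix.mul_apply, mono_apply]

lemma comp_perm_eq_iff (σ : Equiv.Perm (Fin n)) (J I : Config N n) :
    I = J ∘ σ ↔ J = I ∘ σ.symm := by
  constructor
  · rintro rfl; ext x; simp
  · rintro rfl; ext x; simp

lemma mul_mono_apply (σ : Equiv.Perm (Fin n)) (w : Config N n → ℂ) (B : TOp N n)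
    (J I : Config N n) : (B * mono σ w) J I = B J (I ∘ σ.symm) * w (I ∘ σ.symm) := by
  have h : ∀ L : Config N n, I = L ∘ σ ↔ L = I ∘ σ.symm := fun L => comp_perm_eq_iff σ L I
  simp [Matrix.mul_apply, mono_apply, h]

lemma mono_mul_mono (σ τ : Equiv.Perm (Fin n)) (w w' : Config N n → ℂ) :
    mono σ w * mono τ w' = mono (σ * τ) (fun J => w J * w' (J ∘ σ)) := by
  ext J I
  rw [mono_mul_apply]
  simp only [mono_apply, Function.comp_assoc, Equiv.Perm.coe_mul, mul_ite, mul_zero]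
  congr

lemma mono_add (σ : Equiv.Perm (Fin n)) (w w' : Config N n → ℂ) :
    mono σ w + mono σ w' = mono σ (fun J => w J + w' J) := by
  ext J I
  simp only [mono_apply, Matrix.add_apply]
  split_ifs <;> simp

lemma smul_mono (σ : Equiv.Perm (Fin n)) (r : ℂ) (w : Config N n → ℂ) :
    r • mono σ w = mono σ (fun J => r * w J) := by
  ext J I
  simp only [mono_apply, Matrix.smul_apply]
  split_ifs <;> simp

lemma mono_zero (σ : Equiv.Perm (Fin n)) : mono σ (fun _ : Config N n => 0) = 0 := by
  ext J I
  simp [mono_apply]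

lemma mono_one : mono 1 (fun _ : Config N n => 1) = 1 := by
  ext J I
  simp [mono_apply, Matrix.one_apply, eq_comm]

lemma sum_mono {ι : Type*} (s : Finset ι) (σ : Equiv.Perm (Fin n)) (w : ι → Config N n → ℂ) :
    ∑ x ∈ s, mono σ (w x) = mono σ (fun J => ∑ x ∈ s, w x J) := by
  ext J I
  rw [Matrix.sum_apply]
  simp only [mono_apply]
  split_ifs <;> simp

lemma mono_congr (σ : Equiv.Perm (Fin n)) {w w' : Config N n → ℂ} (h : ∀ J, w J = w' J) :
    mono σ w = mono σ w' := by
  rw [funext h]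

lemma mono_eq_zero (σ : Equiv.Perm (Fin n)) {w : Config N n → ℂ} (h : ∀ J, w J = 0) :
    mono σ w = 0 := by
  rw [mono_congr σ h, mono_zero]

/-- The diagonal operator `e_{i,i}^{(a)}`. -/
def eOp (a : Fin n) (i : Fin N) : TOp N n := mono 1 fun J => if J a = i then 1 else 0

lemma actOne_diagonal (a : Fin n) (p : Fin N → ℂ) :
    actOne a (Matrix.diagonal p) = mono 1 fun J : Config N n => p (J a) := by
  ext J I
  simp only [actOne, Matrix.of_apply, mono_apply, Matrix.diagonal_apply]
  by_cases h : I = J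
  · subst h; simp
  · rw [if_neg (show ¬ I = J ∘ (1 : Equiv.Perm (Fin n)) from h)]
    by_cases h1 : ∀ c, c ≠ a → J c = I c
    · rw [if_pos h1, if_neg]
      intro h2
      refine h (funext fun c => ?_)
      by_cases hc : c = a
      · rw [hc, h2]
      · rw [h1 c hc]
    · rw [if_neg h1]

lemma actOne_matUnit (a : Fin n) (i : Fin N) : actOne a (matUnit i i) = eOp (n := n) a i := by
  have : matUnit i i = Matrix.diagonal (fun k => if k = i then (1 : ℂ) else 0) := by
    ext k l
    simp only [matUnit, Matrix.single_apply, Matrix.diagonal_apply]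
    by_cases h : i = k
    · subst h; simp
    · simp [h, Ne.symm h]
  rw [this, actOne_diagonal]
  rfl

lemma pPow_eq (a : Fin n) (p : Fin N → ℂ) :
    pPow a p = mono 1 fun J : Config N n => p (J a) := actOne_diagonal a p

lemma comp_swap_eq_iff {a b : Fin n} (hab : a ≠ b) (J I : Config N n) :
    I = J ∘ Equiv.swap a b ↔
      (∀ c, c ≠ a → c ≠ b → J c = I c) ∧ I a = J b ∧ I b = J a := by
  constructor
  · rintro rfl
    refine ⟨fun c h1 h2 => by simp [Equiv.swap_apply_of_ne_of_ne h1 h2], by simp, by simp⟩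
  · rintro ⟨h1, h2, h3⟩
    ext c
    by_cases ha : c = a
    · subst ha; simp [h2]
    by_cases hb : c = b
    · subst hb; simp [h3]
    simp [Equiv.swap_apply_of_ne_of_ne ha hb, h1 c ha hb]

lemma Rlim_apply (u : ℂ) (x y : Fin N × Fin N) :
    Rlim N u x y = (if x = y.swap then 1 else 0) + if x = y ∧ x.1 < x.2 then u else 0 := by
  have h : ∀ i j : Fin N, (matUnit i i ⊗ₖ matUnit j j) x y
      = if i = x.1 ∧ i = y.1 ∧ j = x.2 ∧ j = y.2 then (1 : ℂ) else 0 := by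
    intro i j
    simp only [Matrix.kroneckerMap_apply, matUnit, Matrix.single_apply]
    rw [ite_zero_mul_ite_zero, mul_one]
    exact if_congr and_assoc rfl rfl
  simp only [Rlim, Matrix.add_apply, flipOp, Matrix.of_apply, Matrix.smul_apply, Matrix.sum_apply,
    h]
  congr 1
  by_cases hxy : x = y ∧ x.1 < x.2
  · obtain ⟨rfl, hlt⟩ := hxy
    rw [Finset.sum_eq_single x.1, Finset.sum_eq_single x.2]
    · simp [hlt]
    · intro j _ hj; simp [hj]
    · intro hj; simp [hlt] at hj
    · intro i _ hi; simp [hi]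
    · simp
  · rw [if_neg hxy, Finset.sum_eq_zero, smul_zero]
    intro i _
    refine Finset.sum_eq_zero fun j hj => ?_
    rw [if_neg]
    rintro ⟨h1, h2, h3, h4⟩
    refine hxy ⟨Prod.ext (h1 ▸ h2) (h3 ▸ h4), ?_⟩
    rw [← h1, ← h3]
    exact Finset.mem_Ioi.1 hj

/-- The flip permutes two factors, and the deformation term is diagonal and sees only the order of
the two labels. -/
lemma actTwo_Rlim {a b : Fin n} (hab : a ≠ b) (u : ℂ) :
    actTwo a b (Rlim N u) = mono (Equiv.swap a b) (fun _ => 1)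
      + mono 1 (fun J => if J a < J b then u else 0) := by
  ext J I
  simp only [actTwo, Matrix.of_apply, Rlim_apply, Matrix.add_apply, mono_apply,
    comp_swap_eq_iff hab]
  by_cases h : ∀ c, c ≠ a → c ≠ b → J c = I c
  · have h2 : (J a, J b) = (I a, I b) ↔ I = J := by
      rw [Prod.mk.injEq]
      constructor
      · rintro ⟨ha, hb⟩
        ext c
        by_cases hca : c = a
        · rw [hca, ha]
        by_cases hcb : c = b
        · rw [hcb, hb]
        rw [h c hca hcb]
      · rintro rfl; simp
    have h3 : (J a, J b) = (I a, I b).swap ↔ I a = J b ∧ I b = J a := by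
      simp only [Prod.swap_prod_mk, Prod.mk.injEq]
      tauto
    have h4 : I = J ∘ (1 : Equiv.Perm (Fin n)) ↔ I = J := Iff.rfl
    rw [if_pos h]
    simp only [h2, h3, h4]
    congr 1
    · exact if_congr ⟨fun h' => ⟨h, h'⟩, fun h' => h'.2⟩ rfl rfl
    · by_cases h5 : I = J
      · subst h5; simp
      · rw [if_neg h5, if_neg]
        rintro ⟨h6, -⟩
        exact h5 h6
  · rw [if_neg h, if_neg (fun h' => h h'.1), if_neg]
    · simp
    · rintro rfl; exact h fun c _ _ => rfl

end Mono

/-! ### The length of a configuration is its number of inversions -/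

section Length

variable {N n : ℕ}

/-- The number of inversions of a word. -/
def inv (I : Config N n) : ℕ :=
  ((Finset.univ : Finset (Fin n × Fin n)).filter (fun x => x.1 < x.2 ∧ I x.2 < I x.1)).card

lemma mem_block (I : Config N n) (i : Fin N) (a : Fin n) : a ∈ block I i ↔ I a = i := by
  simp [block]

lemma mem_minBlock (I : Config N n) (i : Fin N) (a : Fin n) : a ∈ minBlock I i ↔
    ∑ j ∈ Finset.Iio i, weight I j ≤ (a : ℕ) ∧ (a : ℕ) < ∑ j ∈ Finset.Iic i, weight I j := by
  simp [minBlock]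

lemma lt_of_mem_minBlock {I : Config N n} {i j : Fin N} {a b : Fin n} (hij : i < j)
    (ha : a ∈ minBlock I i) (hb : b ∈ minBlock I j) : a < b := by
  rw [mem_minBlock] at ha hb
  have h : ∑ k ∈ Finset.Iic i, weight I k ≤ ∑ k ∈ Finset.Iio j, weight I k :=
    Finset.sum_le_sum_of_subset fun k hk =>
      Finset.mem_Iio.2 ((Finset.mem_Iic.1 hk).trans_lt hij)
  exact Fin.lt_def.2 (ha.2.trans_le (h.trans hb.1))

/-- The blocks of the minimal partition lie in increasing order, so the inverse of σ carries each
inversion of the word to an inversion of σ. -/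
lemma inv_le_permLength {I : Config N n} {σ : Equiv.Perm (Fin n)}
    (h : ∀ i, (minBlock I i).map σ.toEmbedding = block I i) : inv I ≤ permLength σ := by
  have key : ∀ c, σ.symm c ∈ minBlock I (I c) := by
    intro c
    have : c ∈ (minBlock I (I c)).map σ.toEmbedding := by
      rw [h, mem_block]
    obtain ⟨d, hd, rfl⟩ := Finset.mem_map.1 this
    simpa using hd
  refine Finset.card_le_card_of_injOn (fun x => (σ.symm x.2, σ.symm x.1)) ?_ ?_
  · intro x hx
    have hx' : x.1 < x.2 ∧ I x.2 < I x.1 := by simpa using hx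
    simpa [hx'.1] using lt_of_mem_minBlock hx'.2 (key x.2) (key x.1)
  · intro x _ y _ hxy
    simp only [Prod.mk.injEq, EmbeddingLike.apply_eq_iff_eq] at hxy
    exact Prod.ext hxy.2 hxy.1

lemma sum_weight_eq_card (I : Config N n) (s : Finset (Fin N)) :
    ∑ j ∈ s, weight I j = (Finset.univ.filter fun a => I a ∈ s).card := by
  rw [Finset.card_eq_sum_card_fiberwise (f := I) (t := s) (fun a ha => by simpa using ha)]
  refine Finset.sum_congr rfl fun j hj => ?_
  rw [weight, block]
  congr 1
  ext a
  simp only [Finset.mem_filter, Finset.mem_univ, true_and]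
  exact ⟨fun h => ⟨h ▸ hj, h⟩, fun h => h.2⟩

lemma lt_card_iff_of_monotone {P : Fin n → Prop} [DecidablePred P]
    (hP : ∀ a b, a ≤ b → P b → P a) (a : Fin n) :
    (a : ℕ) < (Finset.univ.filter P).card ↔ P a := by
  constructor
  · intro h
    by_contra ha
    have hsub : Finset.univ.filter P ⊆ Finset.Iio a := by
      intro b hb
      rw [Finset.mem_Iio]
      by_contra hab
      exact ha (hP a b (not_lt.1 hab) (by simpa using hb))
    have := Finset.card_le_card hsub
    rw [Fin.card_Iio] at this
    omega
  · intro h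
    have hsub : Finset.Iic a ⊆ Finset.univ.filter P := by
      intro b hb
      simpa using hP b a (Finset.mem_Iic.1 hb) h
    have := Finset.card_le_card hsub
    rw [Fin.card_Iic] at this
    omega

/-- In the sorted word, the labels of a down-closed set fill an initial segment of positions. -/
lemma lt_sum_weight_iff (I : Config N n) (s : Finset (Fin N))
    (hs : ∀ i j, i ≤ j → j ∈ s → i ∈ s) (a : Fin n) :
    (a : ℕ) < ∑ j ∈ s, weight I j ↔ I (Tuple.sort I a) ∈ s := by
  have hm : Monotone (I ∘ Tuple.sort I) := Tuple.monotone_sort I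
  rw [sum_weight_eq_card, ← lt_card_iff_of_monotone (P := fun a => I (Tuple.sort I a) ∈ s)
    (fun a b hab hb => hs _ _ (hm hab) hb) a]
  have : (Finset.univ.filter fun a => I (Tuple.sort I a) ∈ s).card
      = (Finset.univ.filter fun a => I a ∈ s).card := by
    refine Finset.card_bij (fun a _ => Tuple.sort I a) (fun a ha => by simpa using ha)
      (fun a _ b _ h => (Tuple.sort I).injective h) (fun b hb => ⟨(Tuple.sort I).symm b, ?_, ?_⟩)
    · simpa using hb
    · simp
  rw [this]

lemma minBlock_map_sort (I : Config N n) (i : Fin N) :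
    (minBlock I i).map (Tuple.sort I).toEmbedding = block I i := by
  have h : ∀ a, a ∈ minBlock I i ↔ I (Tuple.sort I a) = i := by
    intro a
    rw [mem_minBlock, ← not_lt, lt_sum_weight_iff I _ (fun i j h1 h2 => by
      rw [Finset.mem_Iio] at *; exact h1.trans_lt h2), lt_sum_weight_iff I _ (fun i j h1 h2 => by
      rw [Finset.mem_Iic] at *; exact h1.trans h2)]
    simp only [Finset.mem_Iio, Finset.mem_Iic, not_lt]
    exact ⟨fun h => le_antisymm h.2 h.1, fun h => ⟨h.ge, h.le⟩⟩
  ext c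
  rw [Finset.mem_map_equiv, h, mem_block]
  simp

lemma permLength_sort_le (I : Config N n) : permLength (Tuple.sort I) ≤ inv I := by
  refine Finset.card_le_card_of_injOn (fun x => (Tuple.sort I x.2, Tuple.sort I x.1)) ?_ ?_
  · intro x hx
    have hx' : x.1 < x.2 ∧ Tuple.sort I x.2 < Tuple.sort I x.1 := by simpa using hx
    have hle : I (Tuple.sort I x.1) ≤ I (Tuple.sort I x.2) := Tuple.monotone_sort I hx'.1.le
    have hne : I (Tuple.sort I x.1) ≠ I (Tuple.sort I x.2) := by
      intro heq
      -- Stability of the sort: positions with equal labels are never inverted.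
      have := (Tuple.eq_sort_iff.1 (rfl : Tuple.sort I = Tuple.sort I)).2 x.1 x.2 hx'.1 heq
      exact absurd hx'.2 this.not_gt
    simpa [hx'.2] using lt_of_le_of_ne hle hne
  · intro x _ y _ hxy
    simp only [Prod.mk.injEq, EmbeddingLike.apply_eq_iff_eq] at hxy
    exact Prod.ext hxy.2 hxy.1

lemma len_eq_inv (I : Config N n) : len I = inv I := by
  refine le_antisymm ?_ ?_
  · exact le_trans (Nat.sInf_le (by exact ⟨Tuple.sort I, minBlock_map_sort I, rfl⟩))
      (permLength_sort_le I)
  · refine le_csInf ⟨_, Tuple.sort I, minBlock_map_sort I, rfl⟩ ?_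
    rintro _ ⟨σ, hσ, rfl⟩
    exact inv_le_permLength hσ

end Length

/-! ### Admissible pairs -/

section Admissible

variable {N n : ℕ}

lemma inv_eq_sum (I : Config N n) :
    (inv I : ℤ) = ∑ c, ∑ d, (if c < d then 1 else 0) * (if I d < I c then 1 else 0) := by
  rw [inv, Finset.card_filter, ← Finset.sum_product', Finset.univ_product_univ]
  push_cast
  exact Finset.sum_congr rfl fun x _ => by rw [ite_zero_mul_ite_zero, mul_one]

lemma inv_swapAt_eq_sum (a b : Fin n) (I : Config N n) :
    (inv (swapAt a b I) : ℤ) = ∑ c, ∑ d,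
      (if Equiv.swap a b c < Equiv.swap a b d then 1 else 0) * (if I d < I c then 1 else 0) := by
  rw [inv_eq_sum]
  refine Fintype.sum_equiv (Equiv.swap a b) _ _ fun c => ?_
  refine Fintype.sum_equiv (Equiv.swap a b) _ _ fun d => ?_
  rw [Equiv.swap_apply_self, Equiv.swap_apply_self]
  rfl

/-- Only pairs that contain `a` or `b` can change their relative order. Each term fixes `c` or `d`,
which collapses the double sum over positions in `inv_sub_inv_swapAt` to a sum over the positions
strictly between. -/
lemma lt_sub_swap_lt {a b : Fin n} (hab : a < b) (c d : Fin n) :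
    (if c < d then (1 : ℤ) else 0) - (if Equiv.swap a b c < Equiv.swap a b d then 1 else 0)
      = (if c = a then (if d = b then 1 else 0) else 0)
        - (if c = b then (if d = a then 1 else 0) else 0)
        + (if c = a then (if a < d ∧ d < b then 1 else 0) else 0)
        - (if c = b then (if a < d ∧ d < b then 1 else 0) else 0)
        - (if d = a then (if a < c ∧ c < b then 1 else 0) else 0)
        + (if d = b then (if a < c ∧ c < b then 1 else 0) else 0) := by
  simp only [Equiv.swap_apply_def]
  by_cases h1 : c = a
  · subst h1
    grind
  by_cases h2 : c = b
  · subst h2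
    grind
  grind

lemma inv_sub_inv_swapAt {a b : Fin n} (hab : a < b) (I : Config N n) :
    (inv I : ℤ) - inv (swapAt a b I) = (if I b < I a then 1 else 0) - (if I a < I b then 1 else 0)
      + ∑ e, if a < e ∧ e < b then
          (if I e < I a then (1 : ℤ) else 0) - (if I e < I b then 1 else 0)
          - (if I a < I e then 1 else 0) + (if I b < I e then 1 else 0) else 0 := by
  have h : (inv I : ℤ) - inv (swapAt a b I) = ∑ c, ∑ d,
      ((if c = a then (if d = b then 1 else 0) else 0)
        - (if c = b then (if d = a then 1 else 0) else 0)
        + (if c = a then (if a < d ∧ d < b then 1 else 0) else 0)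
        - (if c = b then (if a < d ∧ d < b then 1 else 0) else 0)
        - (if d = a then (if a < c ∧ c < b then 1 else 0) else 0)
        + (if d = b then (if a < c ∧ c < b then 1 else 0) else 0))
        * (if I d < I c then (1 : ℤ) else 0) := by
    rw [inv_eq_sum, inv_swapAt_eq_sum, ← Finset.sum_sub_distrib]
    refine Finset.sum_congr rfl fun c _ => ?_
    rw [← Finset.sum_sub_distrib]
    refine Finset.sum_congr rfl fun d _ => ?_
    rw [← sub_mul, lt_sub_swap_lt hab]
  rw [h]
  simp only [add_mul, sub_mul, Finset.sum_add_distrib, Finset.sum_sub_distrib, ite_mul, zero_mul,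
    one_mul, Finset.sum_ite_eq', Finset.mem_univ, if_true, Finset.sum_ite_irrel,
    Finset.sum_const_zero]
  have h2 : ∀ e, (if a < e ∧ e < b then
          (if I e < I a then (1 : ℤ) else 0) - (if I e < I b then 1 else 0)
          - (if I a < I e then 1 else 0) + (if I b < I e then 1 else 0) else 0)
      = (if a < e ∧ e < b then (if I e < I a then (1 : ℤ) else 0) else 0)
        - (if a < e ∧ e < b then (if I e < I b then (1 : ℤ) else 0) else 0)
        - (if a < e ∧ e < b then (if I a < I e then (1 : ℤ) else 0) else 0)
        + (if a < e ∧ e < b then (if I b < I e then (1 : ℤ) else 0) else 0) := by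
    intro e
    split_ifs <;> simp
  simp only [h2, Finset.sum_add_distrib, Finset.sum_sub_distrib]
  ring

/-- The contribution of a label `v` to the length difference of the exchange of two positions
with labels `lo < hi`. -/
def interWeight (lo hi v : Fin N) : ℤ :=
  (if v = lo then 1 else 0) + (if v = hi then 1 else 0) + 2 * (if lo < v ∧ v < hi then 1 else 0)

lemma interWeight_nonneg (lo hi v : Fin N) : 0 ≤ interWeight lo hi v := by
  unfold interWeight
  split_ifs <;> norm_num

lemma interWeight_eq_zero_iff {lo hi : Fin N} (h : lo < hi) (v : Fin N) :
    interWeight lo hi v = 0 ↔ v < lo ∨ hi < v := by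
  unfold interWeight
  grind

lemma inv_sub_inv_swapAt_of_gt {a b : Fin n} (hab : a < b) {I : Config N n} (hI : I b < I a) :
    (inv I : ℤ) - inv (swapAt a b I)
      = 1 + ∑ e, if a < e ∧ e < b then interWeight (I b) (I a) (I e) else 0 := by
  rw [inv_sub_inv_swapAt hab, if_pos hI, if_neg hI.not_gt, sub_zero]
  congr 1
  refine Finset.sum_congr rfl fun e _ => if_congr Iff.rfl ?_ rfl
  unfold interWeight
  grind

lemma inv_sub_inv_swapAt_of_lt {a b : Fin n} (hab : a < b) {I : Config N n} (hI : I a < I b) :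
    (inv (swapAt a b I) : ℤ) - inv I
      = 1 + ∑ e, if a < e ∧ e < b then interWeight (I a) (I b) (I e) else 0 := by
  have h := inv_sub_inv_swapAt hab I
  rw [if_pos hI, if_neg hI.not_gt] at h
  rw [← neg_sub, h, neg_add, ← Finset.sum_neg_distrib]
  congr 1
  refine Finset.sum_congr rfl fun e _ => ?_
  unfold interWeight
  grind

lemma mNum_comm (a b : Fin n) (I : Config N n) : mNum a b I = mNum b a I := by
  unfold mNum
  rw [min_comm, max_comm, add_comm (weight I (I a))]

/-- With m written as a total over all positions, comparing it with a length difference, which is a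
sum over an inner segment, leaves a sum over the complementary arc. -/
lemma mNum_eq_sum {a b : Fin n} {I : Config N n} (hI : I a < I b) :
    (mNum a b I : ℤ) = ∑ e, interWeight (I a) (I b) (I e) := by
  have h : ∀ i, (weight I i : ℤ) = ∑ e, if I e = i then 1 else 0 := by
    intro i
    rw [weight, block, Finset.card_filter]
    push_cast
    rfl
  unfold mNum interWeight
  rw [min_eq_left hI.le, max_eq_right hI.le, sum_weight_eq_card, Finset.card_filter]
  push_cast
  rw [h, h, Finset.sum_add_distrib, Finset.sum_add_distrib, Finset.mul_sum]
  simp only [Finset.mem_Ioo]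

/-- `d` lies strictly between `b` and `c` when one goes cyclically to the right from `b`. -/
def CycBetween (b c d : Fin n) : Prop := (b < d ∧ d < c) ∨ (c < b ∧ (b < d ∨ d < c))

lemma swapAt_comm (a b : Fin n) (I : Config N n) : swapAt a b I = swapAt b a I := by
  rw [swapAt, Equiv.swap_comm, swapAt]

lemma admissible_comm (a b : Fin n) (I : Config N n) :
    (AdmissibleFirst a b I ∨ AdmissibleSecond a b I) ↔
      (AdmissibleFirst b a I ∨ AdmissibleSecond b a I) := by
  unfold AdmissibleFirst AdmissibleSecond
  rw [swapAt_comm, mNum_comm, ne_comm]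

/-- If b < c the exchange lowers the length by 1 plus the weights strictly between, so only the
first kind is possible. If c < b it raises the length by 1 plus those weights, so only the second
kind is possible, and it holds when the weights outside the segment add up to zero. The weights are
nonnegative and vanish exactly off the closed interval of labels. -/
lemma admissible_iff {b c : Fin n} {I : Config N n} (hI : I c < I b) :
    (AdmissibleFirst b c I ∨ AdmissibleSecond b c I) ↔
      ∀ d, CycBetween b c d → I d < I c ∨ I b < I d := by
  have hm := mNum_eq_sum hI
  unfold AdmissibleFirst AdmissibleSecond
  rw [len_eq_inv, len_eq_inv]
  rcases lt_trichotomy b c with hbc | rfl | hbc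
  · have h := inv_sub_inv_swapAt_of_gt hbc hI
    have hnn : ∀ e, 0 ≤ (if b < e ∧ e < c then interWeight (I c) (I b) (I e) else 0) := by
      intro e
      split_ifs
      · exact interWeight_nonneg _ _ _
      · rfl
    -- Positivity of m excludes the second kind when the exchange lowers the length.
    have hpos : 0 < (mNum b c I : ℤ) := by
      have : 0 < weight I (I b) := Finset.card_pos.2 ⟨b, (mem_block _ _ _).2 rfl⟩
      unfold mNum
      push_cast
      positivity
    have h0 := Finset.sum_nonneg (s := Finset.univ) fun e _ => hnn e
    have h1 := Finset.sum_eq_zero_iff_of_nonneg (s := Finset.univ) fun e _ => hnn e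
    trans (∑ e, if b < e ∧ e < c then interWeight (I c) (I b) (I e) else 0) = 0
    · constructor
      · rintro (h2 | ⟨-, h2⟩) <;> omega
      · intro h2
        left; omega
    · rw [h1]
      refine forall_congr' fun d => ?_
      rw [← interWeight_eq_zero_iff hI]
      simp only [Finset.mem_univ, true_imp_iff, CycBetween, hbc.not_gt, false_and, or_false,
        ite_eq_right_iff]
  · exact absurd hI (lt_irrefl _)
  · have h := inv_sub_inv_swapAt_of_lt hbc hI
    rw [swapAt_comm] at h
    have hnn : ∀ e, 0 ≤ (if b < e ∨ e < c then interWeight (I c) (I b) (I e) else 0) := by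
      intro e
      split_ifs
      · exact interWeight_nonneg _ _ _
      · rfl
    have h1 := Finset.sum_eq_zero_iff_of_nonneg (s := Finset.univ) fun e _ => hnn e
    have h0 : 0 ≤ ∑ e, if c < e ∧ e < b then interWeight (I c) (I b) (I e) else 0 := by
      refine Finset.sum_nonneg fun e _ => ?_
      split_ifs
      · exact interWeight_nonneg _ _ _
      · rfl
    -- The 2 is the contribution of the end positions `b` and `c` themselves, of weight 1 each.
    have h2 : (mNum c b I : ℤ) = 2
        + (∑ e, if c < e ∧ e < b then interWeight (I c) (I b) (I e) else 0)
        + ∑ e, if b < e ∨ e < c then interWeight (I c) (I b) (I e) else 0 := by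
      have h3 : ∀ e, interWeight (I c) (I b) (I e) = (if e = b then 1 else 0)
          + (if e = c then 1 else 0) + (if c < e ∧ e < b then interWeight (I c) (I b) (I e) else 0)
          + (if b < e ∨ e < c then interWeight (I c) (I b) (I e) else 0) := by
        intro e
        unfold interWeight
        grind
      rw [hm, Finset.sum_congr rfl fun e _ => h3 e]
      simp [Finset.sum_add_distrib]
    rw [mNum_comm b c]
    trans (∑ e, if b < e ∨ e < c then interWeight (I c) (I b) (I e) else 0) = 0
    · constructor
      · rintro (h3 | ⟨-, h3⟩) <;> omega
      · intro h3
        right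
        exact ⟨hI.ne', by omega⟩
    · rw [h1]
      refine forall_congr' fun d => ?_
      rw [← interWeight_eq_zero_iff hI]
      simp only [Finset.mem_univ, true_imp_iff, CycBetween, hbc, true_and,
        ite_eq_right_iff]
      refine imp_congr_left ⟨Or.inr, ?_⟩
      rintro (⟨h3, h4⟩ | h3)
      · exact absurd (h3.trans h4) hbc.not_gt
      · exact h3

open Classical in
/-- The coefficient at `v_J` in the exchange of the label `j` at position `b` with the label `i`
at position `c`, when no label of `[i, j]` lies cyclically between them. -/
def hopWeight (i j : Fin N) (b c : Fin n) (J : Config N n) : ℂ :=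
  if J b = i ∧ J c = j ∧ ∀ d, CycBetween b c d → J d < i ∨ j < J d then 1 else 0

/-- The operator that moves the label `j` from position `b` cyclically to the right, to position
`c`, in exchange with the label `i`. -/
def hop (i j : Fin N) (b c : Fin n) : TOp N n := mono (Equiv.swap b c) (hopWeight i j b c)

lemma ite_eq_ite_of_iff {p q : Prop} {ip : Decidable p} {iq : Decidable q} (h : p ↔ q) (x y : ℂ) :
    (if p then x else y) = if q then x else y := if_congr h rfl rfl

lemma Qop_comm (i j : Fin N) (a b : Fin n) : Qop i j a b = Qop j i b a := by
  ext J I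
  simp only [Qop, Matrix.of_apply]
  refine ite_eq_ite_of_iff ?_ _ _
  rw [admissible_comm, swapAt_comm]
  tauto

/-- `Qop` tests the labels of the input and `hop` those of the output. The labels on the arc are not
touched by the exchange, so the two tests agree. -/
lemma Qop_eq_hop {i j : Fin N} (hij : i < j) {b c : Fin n} (hbc : b ≠ c) :
    Qop j i b c = hop i j b c := by
  ext J I
  simp only [Qop, hop, Matrix.of_apply, mono_apply, hopWeight, ← ite_and]
  refine ite_eq_ite_of_iff ?_ _ _
  have hsw : J = swapAt b c I ↔ I = J ∘ Equiv.swap b c := by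
    rw [comp_perm_eq_iff, Equiv.symm_swap]; rfl
  rw [hsw]
  constructor
  · rintro ⟨h1, h2, h3, rfl⟩
    have h1' : J c = j := by simpa using h1
    have h2' : J b = i := by simpa using h2
    refine ⟨rfl, h2', h1', fun d hd => ?_⟩
    rw [admissible_iff (by rw [h1, h2]; exact hij)] at h3
    have hdb : d ≠ b := by rintro rfl; unfold CycBetween at hd; grind
    have hdc : d ≠ c := by rintro rfl; unfold CycBetween at hd; grind
    have := h3 d hd
    rw [h1, h2] at this
    simpa [Equiv.swap_apply_of_ne_of_ne hdb hdc] using this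
  · rintro ⟨rfl, h1, h2, h3⟩
    have h1' : (J ∘ Equiv.swap b c) b = j := by simpa using h2
    have h2' : (J ∘ Equiv.swap b c) c = i := by simpa using h1
    refine ⟨h1', h2', ?_, rfl⟩
    rw [admissible_iff (by rw [h1', h2']; exact hij)]
    intro d hd
    have hdb : d ≠ b := by rintro rfl; unfold CycBetween at hd; grind
    have hdc : d ≠ c := by rintro rfl; unfold CycBetween at hd; grind
    rw [h1', h2']
    simpa [Equiv.swap_apply_of_ne_of_ne hdb hdc] using h3 d hd

end Admissible

/-! ### The quantum exchange operators -/

section Exchange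

variable {N n : ℕ}

/-- The nil-Coxeter operator of the adjacent positions `a`, `a'`. -/
def nilOp (a a' : Fin n) : TOp N n :=
  mono (Equiv.swap a a') fun J => if J a' < J a then 1 else 0

/-- The weight of the exchange of positions `b` and `c`: the exchanges across the right end carry
the quantum parameter `p j / p i`. -/
def wrapWeight (i j : Fin N) (p : Fin N → ℂ) (b c : Fin n) : ℂ := if b < c then 1 else p j / p i

/-- The sum of all exchanges of labels `j` and `i`, weighted by quantum parameters. -/
def exchOp (i j : Fin N) (p : Fin N → ℂ) : TOp N n :=
  ∑ x : Fin n × Fin n, wrapWeight i j p x.1 x.2 • hop i j x.1 x.2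

lemma hop_self {i j : Fin N} (hij : i < j) (b : Fin n) : hop i j b b = 0 :=
  mono_eq_zero _ fun J => by
    rw [hopWeight, if_neg]
    rintro ⟨h1, h2, -⟩
    exact hij.ne (h1.symm.trans h2)

/-- The combinatorial core of passing T through a hop. When the adjacent transposition moves an
endpoint of the arc, just one neighbour enters or leaves the arc. The arc condition at that
neighbour together with the descent test on one side says the same as the descent test alone on the
other. If no endpoint moves, both positions are on the arc or both are off it. -/
lemma nil_hop_condition {i j : Fin N} {a a' B C : Fin n} (haa : (a : ℕ) + 1 = a')
    (h1 : ¬ (B = a ∧ C = a')) (h2 : ¬ (B = a' ∧ C = a)) (hBC : B ≠ C) (hij : i < j)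
    (J : Config N n) :
    (J a' < J a ∧ J B = i ∧ J C = j ∧ ∀ d, CycBetween (Equiv.swap a a' B) (Equiv.swap a a' C)
        (Equiv.swap a a' d) → J d < i ∨ j < J d) ↔
      (J B = i ∧ J C = j ∧ ∀ d, CycBetween B C d → J d < i ∨ j < J d) ∧
        J (Equiv.swap B C a') < J (Equiv.swap B C a) := by
  have hne : a ≠ a' := by rintro rfl; omega
  have hcyc : ∀ d, d ≠ a → d ≠ a' → (CycBetween (Equiv.swap a a' B) (Equiv.swap a a' C)
      (Equiv.swap a a' d) ↔ CycBetween B C d) := by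
    intro d hda hda'
    simp only [Equiv.swap_apply_def, CycBetween]
    grind
  by_cases hBa : B = a
  · subst hBa
    have hC : C ≠ B ∧ C ≠ a' := by tauto
    rw [Equiv.swap_apply_left, Equiv.swap_apply_of_ne_of_ne hne.symm hC.2.symm]
    have e1 : ¬ CycBetween (Equiv.swap B a' B) (Equiv.swap B a' C) (Equiv.swap B a' a') := by
      simp only [Equiv.swap_apply_def, CycBetween]
      grind
    have e2 : CycBetween B C a' := by
      simp only [CycBetween]
      grind
    have e3 : ¬ CycBetween B C B := by
      simp only [CycBetween]
      grind
    have e4 : ¬ CycBetween (Equiv.swap B a' B) (Equiv.swap B a' C) (Equiv.swap B a' B) := by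
      simp only [Equiv.swap_apply_def, CycBetween]
      grind
    grind
  by_cases hBa' : B = a'
  · subst hBa'
    have hC : C ≠ a ∧ C ≠ B := by tauto
    rw [Equiv.swap_apply_left, Equiv.swap_apply_of_ne_of_ne hne hC.1.symm]
    have e1 : CycBetween (Equiv.swap a B B) (Equiv.swap a B C) (Equiv.swap a B a) := by
      simp only [Equiv.swap_apply_def, CycBetween]
      grind
    have e2 : ¬ CycBetween B C a := by
      simp only [CycBetween]
      grind
    have e3 : ¬ CycBetween B C B := by
      simp only [CycBetween]
      grind
    have e4 : ¬ CycBetween (Equiv.swap a B B) (Equiv.swap a B C) (Equiv.swap a B B) := by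
      simp only [Equiv.swap_apply_def, CycBetween]
      grind
    grind
  by_cases hCa : C = a
  · subst hCa
    rw [Equiv.swap_apply_right, Equiv.swap_apply_of_ne_of_ne (Ne.symm hBa') hne.symm]
    have e1 : CycBetween (Equiv.swap C a' B) (Equiv.swap C a' C) (Equiv.swap C a' a') := by
      simp only [Equiv.swap_apply_def, CycBetween]
      grind
    have e2 : ¬ CycBetween B C a' := by
      simp only [CycBetween]
      grind
    have e3 : ¬ CycBetween B C C := by
      simp only [CycBetween]
      grind
    have e4 : ¬ CycBetween (Equiv.swap C a' B) (Equiv.swap C a' C) (Equiv.swap C a' C) := by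
      simp only [Equiv.swap_apply_def, CycBetween]
      grind
    grind
  by_cases hCa' : C = a'
  · subst hCa'
    rw [Equiv.swap_apply_right, Equiv.swap_apply_of_ne_of_ne (Ne.symm hBa) hne]
    have e1 : ¬ CycBetween (Equiv.swap a C B) (Equiv.swap a C C) (Equiv.swap a C a) := by
      simp only [Equiv.swap_apply_def, CycBetween]
      grind
    have e2 : CycBetween B C a := by
      simp only [CycBetween]
      grind
    have e3 : ¬ CycBetween B C C := by
      simp only [CycBetween]
      grind
    have e4 : ¬ CycBetween (Equiv.swap a C B) (Equiv.swap a C C) (Equiv.swap a C C) := by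
      simp only [Equiv.swap_apply_def, CycBetween]
      grind
    grind
  rw [Equiv.swap_apply_of_ne_of_ne (Ne.symm hBa) (Ne.symm hCa),
    Equiv.swap_apply_of_ne_of_ne (Ne.symm hBa') (Ne.symm hCa')]
  have e1 : CycBetween (Equiv.swap a a' B) (Equiv.swap a a' C) (Equiv.swap a a' a)
      ↔ CycBetween B C a := by
    simp only [Equiv.swap_apply_def, CycBetween]
    grind
  have e2 : CycBetween (Equiv.swap a a' B) (Equiv.swap a a' C) (Equiv.swap a a' a')
      ↔ CycBetween B C a' := by
    simp only [Equiv.swap_apply_def, CycBetween]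
    grind
  grind

lemma nilOp_mul_hop {i j : Fin N} (hij : i < j) {a a' b c : Fin n} (haa : (a : ℕ) + 1 = a')
    (h1 : ¬ (b = a ∧ c = a')) (h2 : ¬ (b = a' ∧ c = a)) (hbc : b ≠ c) :
    nilOp a a' * hop i j b c
      = hop i j (Equiv.swap a a' b) (Equiv.swap a a' c) * nilOp a a' := by
  rw [nilOp, hop, hop, mono_mul_mono, mono_mul_mono, Equiv.mul_swap_eq_swap_mul]
  refine mono_congr _ fun J => ?_
  rw [hopWeight, hopWeight, ite_zero_mul_ite_zero, ite_zero_mul_ite_zero]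
  refine ite_eq_ite_of_iff ?_ _ _
  have key := nil_hop_condition (B := Equiv.swap a a' b) (C := Equiv.swap a a' c) haa
    (by rw [Equiv.swap_apply_eq_iff, Equiv.swap_apply_eq_iff]; simpa using h2)
    (by rw [Equiv.swap_apply_eq_iff, Equiv.swap_apply_eq_iff]; simpa using h1)
    (by simpa using hbc) hij J
  refine Iff.trans ?_ key
  simp only [Equiv.swap_apply_self, Function.comp_apply]
  refine and_congr_right fun _ => and_congr_right fun _ => and_congr_right fun _ => ?_
  constructor
  · intro h d hd
    simpa using h _ hd
  · intro h d hd
    exact h _ (by simpa using hd)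

/-- The diagonal operator of the configurations with label `i` at `a` and `j` at `a'`. -/
def eeOp (a a' : Fin n) (i j : Fin N) : TOp N n :=
  mono 1 fun J => if J a = i ∧ J a' = j then 1 else 0

lemma nilOp_mul_hop_self {i j : Fin N} (hij : i < j) {a a' : Fin n} (haa : (a : ℕ) + 1 = a') :
    nilOp a a' * hop i j a a' = eeOp a a' j i := by
  rw [nilOp, hop, mono_mul_mono, Equiv.swap_mul_self, eeOp]
  refine mono_congr _ fun J => ?_
  rw [hopWeight, ite_zero_mul_ite_zero, mul_one]
  refine ite_eq_ite_of_iff ?_ _ _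
  simp only [Function.comp_apply, Equiv.swap_apply_left, Equiv.swap_apply_right]
  constructor
  · tauto
  · rintro ⟨rfl, rfl⟩
    refine ⟨hij, rfl, rfl, fun d hd => ?_⟩
    unfold CycBetween at hd
    grind

lemma hop_mul_nilOp_self {i j : Fin N} (hij : i < j) {a a' : Fin n} (haa : (a : ℕ) + 1 = a') :
    hop i j a a' * nilOp a a' = eeOp a a' i j := by
  rw [nilOp, hop, mono_mul_mono, Equiv.swap_mul_self, eeOp]
  refine mono_congr _ fun J => ?_
  rw [hopWeight, ite_zero_mul_ite_zero, mul_one]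
  refine ite_eq_ite_of_iff ?_ _ _
  simp only [Function.comp_apply, Equiv.swap_apply_left, Equiv.swap_apply_right]
  constructor
  · tauto
  · rintro ⟨rfl, rfl⟩
    refine ⟨⟨rfl, rfl, fun d hd => ?_⟩, hij⟩
    unfold CycBetween at hd
    grind

/-- This hop leaves the larger label at `a`, a descent, which T kills. -/
lemma nilOp_mul_hop_swap {i j : Fin N} (hij : i < j) (a a' : Fin n) :
    nilOp a a' * hop i j a' a = 0 := by
  rw [nilOp, hop, mono_mul_mono]
  refine mono_eq_zero _ fun J => ?_
  rw [hopWeight, ite_zero_mul_ite_zero, if_neg]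
  simp only [Function.comp_apply, Equiv.swap_apply_left, Equiv.swap_apply_right]
  grind

lemma hop_swap_mul_nilOp {i j : Fin N} (hij : i < j) (a a' : Fin n) :
    hop i j a' a * nilOp a a' = 0 := by
  rw [nilOp, hop, mono_mul_mono]
  refine mono_eq_zero _ fun J => ?_
  rw [hopWeight, ite_zero_mul_ite_zero, if_neg]
  simp only [Function.comp_apply, Equiv.swap_apply_left, Equiv.swap_apply_right]
  grind

/-- After the second sum is relabelled by the transposition, the hops cancel pairwise. Only the hop
from `a` to `a'` survives; as it does not cross the right end, the answer is free of p. -/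
lemma nilOp_exchOp {i j : Fin N} (hij : i < j) (p : Fin N → ℂ) {a a' : Fin n}
    (haa : (a : ℕ) + 1 = a') :
    nilOp a a' * exchOp i j p - exchOp i j p * nilOp a a'
      = eeOp a a' j i - eeOp a a' i j := by
  have hne : a ≠ a' := by rintro rfl; omega
  have hlt : a < a' := by rw [Fin.lt_def]; omega
  have e : exchOp (n := n) i j p = ∑ x : Fin n × Fin n,
      wrapWeight i j p (Equiv.swap a a' x.1) (Equiv.swap a a' x.2) •
        hop i j (Equiv.swap a a' x.1) (Equiv.swap a a' x.2) := by
    rw [exchOp]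
    refine Fintype.sum_equiv ((Equiv.swap a a').prodCongr (Equiv.swap a a')) _ _ fun x => ?_
    simp
  conv_lhs =>
    congr
    · rw [exchOp]
    · rw [e]
  rw [Finset.mul_sum, Finset.sum_mul, ← Finset.sum_sub_distrib]
  rw [Finset.sum_eq_add (a, a') (a', a) (by simp [hne])]
  · simp only [mul_smul_comm, smul_mul_assoc, Equiv.swap_apply_left, Equiv.swap_apply_right]
    rw [nilOp_mul_hop_self hij haa, nilOp_mul_hop_swap hij, hop_mul_nilOp_self hij haa,
      hop_swap_mul_nilOp hij, wrapWeight, if_pos hlt]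
    simp
    abel
  · rintro ⟨b, c⟩ - ⟨h1, h2⟩
    simp only [mul_smul_comm, smul_mul_assoc]
    by_cases hbc : b = c
    · rw [hbc, hop_self hij, hop_self hij]
      simp
    have h1' : ¬ (b = a ∧ c = a') := by simpa using h1
    have h2' : ¬ (b = a' ∧ c = a) := by simpa using h2
    rw [nilOp_mul_hop hij haa h1' h2' hbc]
    -- An adjacent transposition reverses the order of no pair except its own.
    have hw : wrapWeight i j p (Equiv.swap a a' b) (Equiv.swap a a' c) = wrapWeight i j p b c := by
      refine ite_eq_ite_of_iff ?_ _ _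
      simp only [Equiv.swap_apply_def]
      grind
    rw [hw, sub_self]
  · simp
  · simp

end Exchange

/-! ### The dynamical operators and the rotation -/

section Dynamical

variable {N n m : ℕ}

lemma sum_prod_eq_sum_Iio_add_sum_Ioi {M : Type*} [AddCommMonoid M] (f : Fin n → Fin n → M)
    (hf : ∀ a, f a a = 0) :
    ∑ x : Fin n × Fin n, f x.1 x.2
      = (∑ a, ∑ b ∈ Finset.Iio a, f a b) + ∑ a, ∑ b ∈ Finset.Ioi a, f a b := by
  rw [Fintype.sum_prod_type, ← Finset.sum_add_distrib]
  refine Finset.sum_congr rfl fun a _ => ?_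
  have h : ∀ b, f a b = (if b < a then f a b else 0) + if a < b then f a b else 0 := by
    intro b
    rcases lt_trichotomy a b with h | rfl | h
    · rw [if_neg h.not_gt, if_pos h, zero_add]
    · simp [hf]
    · rw [if_neg h.not_gt, if_pos h, add_zero]
  rw [Finset.sum_congr rfl fun b _ => h b, Finset.sum_add_distrib, ← Finset.sum_filter,
    ← Finset.sum_filter]
  congr 2 <;> ext b <;> simp

lemma exchOp_eq_left {i j : Fin N} (hij : i < j) (p : Fin N → ℂ) :
    exchOp (n := n) i j p = (∑ a, ∑ b ∈ Finset.Iio a, Qop i j a b)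
      + ∑ a, ∑ b ∈ Finset.Ioi a, (p j / p i) • Qop i j a b := by
  rw [exchOp, ← Fintype.sum_equiv (Equiv.prodComm (Fin n) (Fin n))
    (fun x => wrapWeight i j p x.2 x.1 • hop i j x.2 x.1) _ fun _ => rfl,
    sum_prod_eq_sum_Iio_add_sum_Ioi (fun a b => wrapWeight i j p b a • hop i j b a)
      fun a => by rw [hop_self hij, smul_zero]]
  congr 1 <;> refine Finset.sum_congr rfl fun a _ => Finset.sum_congr rfl fun b hb => ?_
  · rw [Finset.mem_Iio] at hb
    rw [wrapWeight, if_pos hb, one_smul, Qop_comm, Qop_eq_hop hij hb.ne]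
  · rw [Finset.mem_Ioi] at hb
    rw [wrapWeight, if_neg hb.not_gt, Qop_comm, Qop_eq_hop hij hb.ne']

lemma exchOp_eq_right {i j : Fin N} (hji : j < i) (p : Fin N → ℂ) :
    exchOp (n := n) j i p = (∑ a, ∑ b ∈ Finset.Iio a, (p i / p j) • Qop i j a b)
      + ∑ a, ∑ b ∈ Finset.Ioi a, Qop i j a b := by
  rw [exchOp, sum_prod_eq_sum_Iio_add_sum_Ioi (fun a b => wrapWeight j i p a b • hop j i a b)
      fun a => by rw [hop_self hji, smul_zero]]
  congr 1 <;> refine Finset.sum_congr rfl fun a _ => Finset.sum_congr rfl fun b hb => ?_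
  · rw [Finset.mem_Iio] at hb
    rw [wrapWeight, if_neg hb.not_gt, Qop_eq_hop hji hb.ne']
  · rw [Finset.mem_Ioi] at hb
    rw [wrapWeight, if_pos hb, one_smul, Qop_eq_hop hji hb.ne]

/-- The exchange operators with their signs: `signedExch i j = - signedExch j i`. -/
def signedExch (i j : Fin N) (p : Fin N → ℂ) : TOp N n :=
  if i < j then exchOp i j p else if j < i then -exchOp j i p else 0

/-- The part of the dynamical operator that does not depend on `z`. -/
def exchSum (i : Fin N) (p : Fin N → ℂ) : TOp N n := ∑ j, signedExch i j p

/-- The part of the dynamical operator that is linear in `z`. -/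
def diagSum (i : Fin N) (z : Fin n → ℂ) : TOp N n := ∑ a, z a • eOp a i

lemma signedExch_antisymm (i j : Fin N) (p : Fin N → ℂ) :
    signedExch (n := n) i j p = -signedExch j i p := by
  unfold signedExch
  rcases lt_trichotomy i j with h | rfl | h
  · simp [h, h.not_gt]
  · simp
  · simp [h, h.not_gt]

lemma exchSum_eq (i : Fin N) (p : Fin N → ℂ) : exchSum (n := n) i p
    = ∑ j ∈ Finset.Ioi i, exchOp i j p - ∑ j ∈ Finset.Iio i, exchOp j i p := by
  have h : ∀ j, signedExch (n := n) i j p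
      = (if i < j then exchOp i j p else 0) - if j < i then exchOp j i p else 0 := by
    intro j
    unfold signedExch
    rcases lt_trichotomy i j with h | rfl | h
    · simp [h, h.not_gt]
    · simp
    · simp [h, h.not_gt]
  rw [exchSum, Finset.sum_congr rfl fun j _ => h j, Finset.sum_sub_distrib, ← Finset.sum_filter,
    ← Finset.sum_filter]
  congr 2 <;> ext j <;> simp

/-- The cases b < a and a < b of the definition are the two ways to go around the circle; in both
label ranges the ratio of p's falls on the hops across the right end. -/
lemma Xlim_eq (i : Fin N) (z : Fin n → ℂ) (p : Fin N → ℂ) :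
    Xlim i z p = diagSum i z + exchSum i p := by
  rw [Xlim, exchSum_eq, Finset.sum_congr rfl fun j hj => exchOp_eq_left (Finset.mem_Ioi.1 hj) p,
    Finset.sum_congr rfl fun j hj => exchOp_eq_right (Finset.mem_Iio.1 hj) p]
  have h1 : ∀ (s : Finset (Fin N)) (t : Fin n → Finset (Fin n))
      (f : Fin N → Fin n → Fin n → TOp N n),
      ∑ j ∈ s, ∑ a, ∑ b ∈ t a, f j a b = ∑ a, ∑ b ∈ t a, ∑ j ∈ s, f j a b := by
    intro s t f
    rw [Finset.sum_comm]
    exact Finset.sum_congr rfl fun a _ => Finset.sum_comm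
  simp only [Finset.sum_add_distrib, Finset.sum_sub_distrib, h1, actOne_matUnit]
  rw [diagSum]
  abel

lemma eOp_sum (a : Fin n) : ∑ j : Fin N, eOp a j = 1 := by
  simp only [eOp]
  rw [sum_mono, ← mono_one]
  exact mono_congr _ fun J => by simp

lemma eeOp_eq (a a' : Fin n) (i j : Fin N) : eeOp a a' i j = eOp a i * eOp a' j := by
  rw [eeOp, eOp, eOp, mono_mul_mono, mul_one]
  exact mono_congr _ fun J => by rw [ite_zero_mul_ite_zero, mul_one]; rfl

lemma eOp_commute (a a' : Fin n) (i j : Fin N) : Commute (eOp a i) (eOp a' j) := by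
  rw [Commute, SemiconjBy, eOp, eOp, mono_mul_mono, mono_mul_mono]
  exact mono_congr _ fun J => mul_comm _ _

lemma nilOp_signedExch (i j : Fin N) (p : Fin N → ℂ) {a a' : Fin n} (haa : (a : ℕ) + 1 = a') :
    nilOp a a' * signedExch i j p - signedExch i j p * nilOp a a'
      = eOp a' i * eOp a j - eOp a i * eOp a' j := by
  unfold signedExch
  rcases lt_trichotomy i j with h | rfl | h
  · rw [if_pos h, nilOp_exchOp h p haa, eeOp_eq, eeOp_eq, (eOp_commute a a' j i).eq]
  · simp [(eOp_commute a a' i i).eq]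
  · rw [if_neg h.not_gt, if_pos h, mul_neg, neg_mul, sub_neg_eq_add, neg_add_eq_sub,
      ← neg_sub, nilOp_exchOp h p haa, eeOp_eq, eeOp_eq, (eOp_commute a a' j i).eq, neg_sub]

/-- Summed over j, the quadratic terms of `nilOp_signedExch` become linear because the projections
at one position add up to 1. -/
lemma nilOp_exchSum (i : Fin N) (p : Fin N → ℂ) {a a' : Fin n} (haa : (a : ℕ) + 1 = a') :
    nilOp a a' * exchSum i p - exchSum i p * nilOp a a' = eOp a' i - eOp a i := by
  rw [exchSum, Finset.mul_sum, Finset.sum_mul, ← Finset.sum_sub_distrib,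
    Finset.sum_congr rfl fun j _ => nilOp_signedExch i j p haa, Finset.sum_sub_distrib,
    ← Finset.mul_sum, ← Finset.mul_sum, eOp_sum, eOp_sum, mul_one, mul_one]

lemma nilOp_mul_eOp (a a' b : Fin n) (i : Fin N) :
    nilOp a a' * eOp b i = eOp (Equiv.swap a a' b) i * nilOp a a' := by
  rw [nilOp, eOp, eOp, mono_mul_mono, mono_mul_mono, one_mul, mul_one]
  exact mono_congr _ fun J => mul_comm _ _

/-- The rational braid operator `1 + u T` of the adjacent positions `a`, `a'`. -/
def braidOp (a a' : Fin n) (u : ℂ) : TOp N n := 1 + u • nilOp a a'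

lemma nilOp_mul_diagSum (a a' : Fin n) (i : Fin N) (z : Fin n → ℂ) :
    nilOp a a' * diagSum i z = diagSum i (z ∘ Equiv.swap a a') * nilOp a a' := by
  rw [diagSum, diagSum, Finset.mul_sum, Finset.sum_mul]
  refine Fintype.sum_equiv (Equiv.swap a a') _ _ fun b => ?_
  rw [mul_smul_comm, smul_mul_assoc, nilOp_mul_eOp]
  simp

lemma diagSum_sub_swap {a a' : Fin n} (hne : a ≠ a') (i : Fin N) (z : Fin n → ℂ) :
    diagSum i z - diagSum i (z ∘ Equiv.swap a a') = (z a - z a') • (eOp a i - eOp a' i) := by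
  rw [diagSum, diagSum, ← Finset.sum_sub_distrib, Finset.sum_eq_add a a' hne]
  · simp only [Function.comp_apply, Equiv.swap_apply_left, Equiv.swap_apply_right]
    module
  · rintro b - ⟨h1, h2⟩
    rw [Function.comp_apply, Equiv.swap_apply_of_ne_of_ne h1 h2, sub_self]
  · simp
  · simp

/-- The braid operators intertwine the dynamical operators. -/
lemma braidOp_mul_Xlim (i : Fin N) (z : Fin n → ℂ) (p : Fin N → ℂ) {a a' : Fin n}
    (haa : (a : ℕ) + 1 = a') :
    braidOp a a' (z a - z a') * Xlim i z p
      = Xlim i (z ∘ Equiv.swap a a') p * braidOp a a' (z a - z a') := by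
  have hne : a ≠ a' := by rintro rfl; omega
  have h1 := nilOp_exchSum i p haa
  have h2 := diagSum_sub_swap hne i z
  have h3 := nilOp_mul_diagSum a a' i z
  rw [Xlim_eq, Xlim_eq, braidOp, ← sub_eq_zero]
  set u := z a - z a'
  -- The middle group vanishes, T being equivariant on the diagonal part. The outer two are
  -- u(e_i^{(a)} - e_i^{(a')}) and its negative.
  have : (1 + u • nilOp a a') * (diagSum i z + exchSum i p)
      - (diagSum i (z ∘ Equiv.swap a a') + exchSum i p) * (1 + u • nilOp a a')
      = (diagSum i z - diagSum i (z ∘ Equiv.swap a a'))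
        + u • (nilOp a a' * diagSum i z - diagSum i (z ∘ Equiv.swap a a') * nilOp a a')
        + u • (nilOp a a' * exchSum i p - exchSum i p * nilOp a a') := by
    simp only [add_mul, mul_add, one_mul, mul_one, smul_mul_assoc, mul_smul_comm, smul_sub,
      smul_add]
    abel
  rw [this, h1, h2, h3]
  module

/-- The rotation of the tensor factors with a twist by `p`. -/
def rotOp (p : Fin N → ℂ) : TOp N (m + 1) := mono (finRotate (m + 1)) fun J => p (J 0)

lemma cycBetween_finRotate (b c d : Fin (m + 1)) :
    CycBetween (finRotate (m + 1) b) (finRotate (m + 1) c) (finRotate (m + 1) d)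
      ↔ CycBetween b c d := by
  simp only [CycBetween, Fin.lt_def, coe_finRotate, Fin.ext_iff, Fin.val_last]
  have := b.2
  have := c.2
  have := d.2
  split_ifs <;> omega

/-- Rotation preserves cyclic betweenness, so hops go to hops. The quantum weight changes only if an
endpoint is rotated from the last position to position 0, and there the twist reads different labels
before and after the hop, which compensates exactly by p_j/p_i. -/
lemma rotOp_mul_hop {i j : Fin N} (hij : i < j) {p : Fin N → ℂ} (hp : p i ≠ 0)
    (b c : Fin (m + 1)) :
    rotOp p * (wrapWeight i j p b c • hop i j b c)
      = (wrapWeight i j p (finRotate _ b) (finRotate _ c)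
          • hop i j (finRotate _ b) (finRotate _ c)) * rotOp p := by
  by_cases hbc : b = c
  · rw [hbc, hop_self hij, hop_self hij]
    simp
  rw [mul_smul_comm, smul_mul_assoc, rotOp, hop, hop, mono_mul_mono, mono_mul_mono,
    Equiv.mul_swap_eq_swap_mul, smul_mono, smul_mono]
  refine mono_congr _ fun J => ?_
  have hw : hopWeight i j b c (J ∘ finRotate (m + 1))
      = hopWeight i j (finRotate _ b) (finRotate _ c) J := by
    refine ite_eq_ite_of_iff ?_ _ _
    refine and_congr_right fun _ => and_congr_right fun _ => ?_
    rw [← (finRotate (m + 1)).forall_congr_right (q := fun d => CycBetween (finRotate (m + 1) b)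
      (finRotate (m + 1) c) d → J d < i ∨ j < J d)]
    simp only [cycBetween_finRotate, Function.comp_apply]
  rw [hw]
  by_cases hJ : J (finRotate _ b) = i ∧ J (finRotate _ c) = j
  swap
  · have : hopWeight i j (finRotate _ b) (finRotate _ c) J = 0 := by
      rw [hopWeight, if_neg]
      rintro ⟨h1, h2, -⟩
      exact hJ ⟨h1, h2⟩
    rw [this]
    simp
  obtain ⟨h1, h2⟩ := hJ
  have hb : (finRotate (m + 1) b : ℕ) = if b = Fin.last m then 0 else (b : ℕ) + 1 := coe_finRotate b
  have hc : (finRotate (m + 1) c : ℕ) = if c = Fin.last m then 0 else (c : ℕ) + 1 := coe_finRotate c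
  have hbl := b.2
  have hcl := c.2
  have hne : finRotate (m + 1) b ≠ finRotate (m + 1) c := by simpa using hbc
  simp only [Function.comp_apply]
  generalize finRotate (m + 1) b = B at *
  generalize finRotate (m + 1) c = C at *
  -- The source of the hop comes to position 0: a hop across the end becomes an ordinary one.
  by_cases hB : b = Fin.last m
  · rw [if_pos hB] at hb
    have hB0 : B = 0 := Fin.ext hb
    have hbc' : ¬ b < c := by rw [hB]; exact not_lt.2 (Fin.le_last c)
    have hBC : B < C := by rw [hB0]; exact Fin.pos_iff_ne_zero.2 (hB0 ▸ hne.symm)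
    have e1 : p (J 0) = p i := by rw [← h1, hB0]
    have e2 : p (J (Equiv.swap B C 0)) = p j := by rw [← hB0, Equiv.swap_apply_left, h2]
    rw [wrapWeight, wrapWeight, if_neg hbc', if_pos hBC, e1, e2]
    field_simp
  rw [if_neg hB] at hb
  -- The target comes to position 0: an ordinary hop becomes one across the end.
  by_cases hC : c = Fin.last m
  · rw [if_pos hC] at hc
    have hC0 : C = 0 := Fin.ext hc
    have hbc' : b < c := by rw [hC]; exact lt_of_le_of_ne (Fin.le_last b) hB
    have hBC : ¬ B < C := by rw [hC0]; exact Fin.not_lt_zero B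
    have e1 : p (J 0) = p j := by rw [← h2, hC0]
    have e2 : p (J (Equiv.swap B C 0)) = p i := by rw [← hC0, Equiv.swap_apply_right, h1]
    rw [wrapWeight, wrapWeight, if_pos hbc', if_neg hBC, e1, e2]
    field_simp
  rw [if_neg hC] at hc
  have e : Equiv.swap B C 0 = 0 := by
    refine Equiv.swap_apply_of_ne_of_ne ?_ ?_
    · rw [ne_eq, Fin.ext_iff, hb]; simp
    · rw [ne_eq, Fin.ext_iff, hc]; simp
  have hw2 : wrapWeight i j p B C = wrapWeight i j p b c := by
    refine ite_eq_ite_of_iff ?_ _ _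
    rw [Fin.lt_def, Fin.lt_def]; omega
  rw [e, hw2]
  ring

lemma rotOp_commute_exchOp {i j : Fin N} (hij : i < j) {p : Fin N → ℂ} (hp : p i ≠ 0) :
    Commute (rotOp (m := m) p) (exchOp i j p) := by
  rw [Commute, SemiconjBy, exchOp, Finset.mul_sum, Finset.sum_mul]
  refine Fintype.sum_equiv ((finRotate (m + 1)).prodCongr (finRotate (m + 1))) _ _ fun x => ?_
  rw [rotOp_mul_hop hij hp]
  rfl

lemma rotOp_commute_exchSum (i : Fin N) {p : Fin N → ℂ} (hp : p ∈ pDomain N) :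
    Commute (rotOp (m := m) p) (exchSum i p) := by
  refine Commute.sum_right _ _ _ fun j _ => ?_
  unfold signedExch
  split_ifs with h1 h2
  · exact rotOp_commute_exchOp h1 (hp i)
  · exact (rotOp_commute_exchOp h2 (hp j)).neg_right
  · exact Commute.zero_right _

end Dynamical

/-! ### Words: rotations and ascending exchanges generate all permutations -/

section Words

variable {α : Type*} {S : List α → Prop}

lemma rotate_append (hrot : ∀ x u, S (x :: u) → S (u ++ [x])) (u w : List α) (h : S (u ++ w)) :
    S (w ++ u) := by
  induction u generalizing w with
  | nil => simpa using h
  | cons x u ih =>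
    have := ih (w ++ [x]) (by simpa using hrot x (u ++ w) h)
    simpa using this

lemma move_left [LinearOrder α]
    (hT : ∀ u x y w, x < y → S (u ++ x :: y :: w) → S (u ++ y :: x :: w)) (y : α)
    (hgt : ∀ z, y < z → ∀ u x w, S (u ++ z :: x :: w) → S (u ++ x :: z :: w)) (u v w : List α)
    (h : S (u ++ v ++ y :: w)) : S (u ++ y :: (v ++ w)) := by
  induction v using List.reverseRecOn generalizing w with
  | nil => simpa using h
  | append_singleton v z ih =>
    have h' : S ((u ++ v) ++ z :: y :: w) := by simpa using h
    have h2 : S ((u ++ v) ++ y :: z :: w) := by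
      rcases lt_trichotomy z y with hz | rfl | hz
      · exact hT _ _ _ _ hz h'
      · exact h'
      · exact hgt z hz _ _ _ h'
    simpa using ih (z :: w) h2

/-- Descending induction on `y`. To carry `y` over its right neighbour, go the long way round:
rotate `y` to the end of the word and move it left until it stands just after `x`. Smaller letters
are passed by the ascending exchange, larger ones by the induction hypothesis. -/
lemma exchange_descent [LinearOrder α] [WellFoundedGT α] (hrot : ∀ x u, S (x :: u) → S (u ++ [x]))
    (hT : ∀ u x y w, x < y → S (u ++ x :: y :: w) → S (u ++ y :: x :: w)) (y : α) :
    ∀ u x w, S (u ++ y :: x :: w) → S (u ++ x :: y :: w) := by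
  induction y using WellFoundedGT.induction with
  | ind y ih =>
    intro u x w h
    have h1 : S (y :: x :: (w ++ u)) := by simpa using rotate_append hrot u _ h
    have h2 : S ([x] ++ (w ++ u) ++ y :: []) := by simpa using hrot _ _ h1
    have h3 : S ((x :: y :: w) ++ u) := by simpa using move_left hT y ih _ _ _ h2
    exact rotate_append hrot _ _ h3

lemma exchange_adjacent [LinearOrder α] [WellFoundedGT α] (hrot : ∀ x u, S (x :: u) → S (u ++ [x]))
    (hT : ∀ u x y w, x < y → S (u ++ x :: y :: w) → S (u ++ y :: x :: w)) (u : List α) (x y : α)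
    (w : List α) (h : S (u ++ y :: x :: w)) : S (u ++ x :: y :: w) :=
  exchange_descent hrot hT y u x w h

lemma closed_under_perm [LinearOrder α] [WellFoundedGT α] (hrot : ∀ x u, S (x :: u) → S (u ++ [x]))
    (hT : ∀ u x y w, x < y → S (u ++ x :: y :: w) → S (u ++ y :: x :: w)) {l l' : List α}
    (hl : l.Perm l') (h : S l) : S l' := by
  have key : ∀ u, S (u ++ l) → S (u ++ l') := by
    clear h
    induction hl with
    | nil => exact fun _ h => h
    | cons x _ ih =>
      intro u h
      simpa using ih (u ++ [x]) (by simpa using h)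
    | swap x y l => exact fun u h => exchange_adjacent hrot hT u x y l h
    | trans _ _ ih1 ih2 => exact fun u h => ih2 u (ih1 u h)
  exact key [] h

end Words

/-! ### Commutativity of the dynamical operators -/

section Commutativity

variable {N n m : ℕ}

/-- Each term of the exchange operator only swaps a label `i` with a label `j`, so it commutes with
diagonal functions that do not notice such a swap. -/
lemma commute_signedExch {i j : Fin N} (p : Fin N → ℂ) {φ : Config N n → ℂ}
    (hφ : ∀ b c J, J b = i → J c = j → φ (J ∘ Equiv.swap b c) = φ J) :
    Commute (signedExch i j p) (mono 1 φ) := by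
  have key : ∀ i j : Fin N, (∀ b c J, J b = i → J c = j → φ (J ∘ Equiv.swap b c) = φ J) →
      Commute (exchOp i j p) (mono 1 φ) := by
    intro i j hφ
    refine Commute.sum_left _ _ _ fun x _ => Commute.smul_left ?_ _
    rw [Commute, SemiconjBy, hop, mono_mul_mono, mono_mul_mono, one_mul, mul_one]
    refine mono_congr _ fun J => ?_
    rw [mul_comm]
    unfold hopWeight
    split_ifs with h1 h2 h2
    · rw [hφ _ _ _ h1.1 h1.2.1]
    · exact absurd h1 h2
    · exact absurd h2 h1
    · simp
  unfold signedExch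
  split_ifs with h1 h2
  · exact key i j hφ
  · refine (key j i fun b c J hb hc => ?_).neg_left
    rw [Equiv.swap_comm]
    exact hφ c b J hc hb
  · exact Commute.zero_left _

lemma signedExch_commute_eOp {i j k : Fin N} (hki : k ≠ i) (hkj : k ≠ j) (p : Fin N → ℂ)
    (a : Fin n) : Commute (signedExch i j p) (eOp a k) := by
  refine commute_signedExch p fun b c J hb hc => ite_eq_ite_of_iff ?_ _ _
  simp only [Function.comp_apply, Equiv.swap_apply_def]
  grind

lemma signedExch_commute_eOp_add {i j : Fin N} (hij : i ≠ j) (p : Fin N → ℂ) (a : Fin n) :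
    Commute (signedExch i j p) (eOp a i + eOp a j) := by
  rw [eOp, eOp, mono_add]
  refine commute_signedExch p fun b c J hb hc => ?_
  simp only [Function.comp_apply, Equiv.swap_apply_def]
  grind

/-- For i ≠ k each side reduces to the one exchange of the labels `i` and `k`. That exchange
commutes with e_i + e_k and changes sign under i ↔ k, and the two signs cancel. -/
lemma eOp_exchSum (i k : Fin N) (p : Fin N → ℂ) (a : Fin n) :
    eOp a i * exchSum k p - exchSum k p * eOp a i
      = eOp a k * exchSum i p - exchSum i p * eOp a k := by
  by_cases hik : i = k
  · rw [hik]
  have key : ∀ i k : Fin N, i ≠ k → eOp a i * exchSum k p - exchSum k p * eOp a i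
      = eOp a i * signedExch k i p - signedExch k i p * eOp a i := by
    intro i k hik
    rw [exchSum, Finset.mul_sum, Finset.sum_mul, ← Finset.sum_sub_distrib, Finset.sum_eq_single i]
    · intro j _ hj
      rw [(signedExch_commute_eOp hik hj.symm p a).eq, sub_self]
    · simp
  rw [key i k hik, key k i (Ne.symm hik), signedExch_antisymm k i]
  have h := (signedExch_commute_eOp_add hik p a).eq
  rw [mul_add, add_mul] at h
  rw [mul_neg, neg_mul, sub_neg_eq_add, neg_add_eq_sub, sub_eq_sub_iff_add_eq_add, h, add_comm]

/-- By the Leibniz rule the commutator with T is a combination of commutators of e's with E's, which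
cancel by `eOp_exchSum` at `a` and at `a'`. -/
lemma nilOp_commute_commutator (i k : Fin N) (p : Fin N → ℂ) {a a' : Fin n}
    (haa : (a : ℕ) + 1 = a') :
    Commute (nilOp a a') (exchSum i p * exchSum k p - exchSum k p * exchSum i p) := by
  have h1 := nilOp_exchSum i p haa
  have h2 := nilOp_exchSum k p haa
  have h3 := eOp_exchSum i k p a
  have h4 := eOp_exchSum i k p a'
  rw [Commute, SemiconjBy, ← sub_eq_zero]
  generalize exchSum i p = x at *
  generalize exchSum k p = y at *
  generalize nilOp a a' = t at *
  have : t * (x * y - y * x) - (x * y - y * x) * t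
      = (t * x - x * t) * y + x * (t * y - y * t) - (t * y - y * t) * x - y * (t * x - x * t) := by
    noncomm_ring
  rw [this, h1, h2]
  have : (eOp a' i - eOp a i) * y + x * (eOp a' k - eOp a k) - (eOp a' k - eOp a k) * x
        - y * (eOp a' i - eOp a i)
      = ((eOp a' i * y - y * eOp a' i) - (eOp a' k * x - x * eOp a' k))
        - ((eOp a i * y - y * eOp a i) - (eOp a k * x - x * eOp a k)) := by
    noncomm_ring
  rw [this, h3, h4, sub_self, sub_self, sub_self]

lemma signedExch_apply_ne_zero {i j : Fin N} {p : Fin N → ℂ} {J I : Config N n}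
    (h : signedExch i j p J I ≠ 0) :
    i ≠ j ∧ ∃ b c, J b = i ∧ J c = j ∧ I = J ∘ Equiv.swap b c := by
  have key : ∀ i j : Fin N, exchOp i j p J I ≠ 0 →
      ∃ b c, J b = i ∧ J c = j ∧ I = J ∘ Equiv.swap b c := by
    intro i j h
    rw [exchOp, Matrix.sum_apply] at h
    obtain ⟨x, -, hx⟩ := Finset.exists_ne_zero_of_sum_ne_zero h
    rw [Matrix.smul_apply, hop, mono_apply] at hx
    have hI : I = J ∘ Equiv.swap x.1 x.2 := by
      by_contra h'
      rw [if_neg h', smul_zero] at hx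
      exact hx rfl
    rw [if_pos hI] at hx
    have hw : hopWeight i j x.1 x.2 J ≠ 0 := right_ne_zero_of_smul hx
    unfold hopWeight at hw
    split_ifs at hw with hc
    · exact ⟨x.1, x.2, hc.1, hc.2.1, hI⟩
    · exact absurd rfl hw
  unfold signedExch at h
  split_ifs at h with h1 h2
  · exact ⟨h1.ne, key i j h⟩
  · obtain ⟨b, c, hb, hc, hI⟩ := key j i (by simpa using h)
    exact ⟨h2.ne', c, b, hc, hb, by rw [hI, Equiv.swap_comm]⟩
  · exact absurd rfl h

/-- A second exchange can restore the word only if it uses the same two labels as the first. -/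
lemma exchSum_apply_mul_apply {i k : Fin N} (hik : i ≠ k) (p : Fin N → ℂ) (J I : Config N n) :
    exchSum i p J I * exchSum k p I J = signedExch i k p J I * signedExch k i p I J := by
  have key : ∀ j l, signedExch i j p J I * signedExch k l p I J ≠ 0 → j = k ∧ l = i := by
    intro j l h
    obtain ⟨h1, b, c, hb, hc, hI⟩ := signedExch_apply_ne_zero (left_ne_zero_of_mul h)
    obtain ⟨h2, b', c', hb', hc', hJ⟩ := signedExch_apply_ne_zero (right_ne_zero_of_mul h)
    have e1 : J b' = l := by rw [hJ]; simpa using hc'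
    have e2 : J (Equiv.swap b c b') = k := by rw [← hb', hI]; rfl
    rw [Equiv.swap_apply_def] at e2
    grind
  rw [exchSum, exchSum, Matrix.sum_apply, Matrix.sum_apply, Finset.sum_mul_sum,
    Finset.sum_eq_single k, Finset.sum_eq_single i]
  · intro l _ hl
    by_contra h
    exact hl (key k l h).2
  · simp
  · intro j _ hj
    refine Finset.sum_eq_zero fun l _ => ?_
    by_contra h
    exact hj (key j l h).1
  · simp

/-- Both products run over the same round trips, and antisymmetry of the signed exchange makes the
summands equal. -/
lemma commutator_apply_self (i k : Fin N) (p : Fin N → ℂ) (J : Config N n) :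
    (exchSum i p * exchSum k p - exchSum k p * exchSum i p : TOp N n) J J = 0 := by
  by_cases hik : i = k
  · rw [hik, sub_self]; rfl
  rw [Matrix.sub_apply, Matrix.mul_apply, Matrix.mul_apply, sub_eq_zero]
  refine Finset.sum_congr rfl fun I _ => ?_
  rw [exchSum_apply_mul_apply hik, exchSum_apply_mul_apply (Ne.symm hik), signedExch_antisymm i k]
  simp

open Classical in
/-- The projection to the span of the rearrangements of `I`. -/
def rearrProj (I : Config N n) : TOp N n :=
  mono 1 fun J => if (List.ofFn J).Perm (List.ofFn I) then 1 else 0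

lemma rearrProj_commute_exchSum (I : Config N n) (i : Fin N) (p : Fin N → ℂ) :
    Commute (rearrProj I) (exchSum i p) := by
  refine Commute.sum_right _ _ _ fun j _ => (commute_signedExch p fun b c J _ _ => ?_).symm
  refine ite_eq_ite_of_iff ?_ _ _
  have h := Equiv.Perm.ofFn_comp_perm (Equiv.swap b c) J
  exact ⟨fun h' => h.symm.trans h', fun h' => h.trans h'⟩

lemma ofFn_antitone_eq {I J : Config N (m + 1)} (hI : ∀ k : Fin m, I k.succ ≤ I k.castSucc)
    (hJ : ∀ k : Fin m, J k.succ ≤ J k.castSucc) (h : (List.ofFn J).Perm (List.ofFn I)) : J = I := by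
  have key : ∀ I : Config N (m + 1), (∀ k : Fin m, I k.succ ≤ I k.castSucc) →
      (List.ofFn I).Pairwise (fun x y => y ≤ x) := fun I hI =>
    List.pairwise_ofFn.2 fun _ _ hab => Fin.antitone_iff_succ_le.2 hI hab.le
  exact List.ofFn_injective (h.eq_of_pairwise (fun a b _ _ h1 h2 => le_antisymm h2 h1)
    (key J hJ) (key I hI))

lemma ofFn_comp_finRotate_symm (I : Config N (m + 1)) {u : List (Fin N)} {x : Fin N}
    (h : List.ofFn I = u ++ [x]) : List.ofFn (I ∘ (finRotate (m + 1)).symm) = x :: u := by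
  rw [List.ofFn_succ', List.concat_eq_append] at h
  obtain ⟨h1, h2⟩ := List.append_inj' h rfl
  rw [List.ofFn_succ]
  have e0 : (finRotate (m + 1)).symm 0 = Fin.last m := by
    rw [Equiv.symm_apply_eq, finRotate_last]
  have e1 : ∀ k : Fin m, (finRotate (m + 1)).symm k.succ = k.castSucc := by
    intro k
    rw [Equiv.symm_apply_eq]
    ext
    rw [coe_finRotate_of_ne_last (Fin.castSucc_lt_last k).ne]
    simp
  simp only [Function.comp_apply, e0, e1, h1]
  congr 1
  simpa using h2

lemma ofFn_comp_swap {I : Config N n} {u w : List (Fin N)} {x y : Fin N}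
    (h : List.ofFn I = u ++ y :: x :: w) : ∃ a a' : Fin n, (a : ℕ) + 1 = a' ∧ I a = y ∧ I a' = x ∧
      List.ofFn (I ∘ Equiv.swap a a') = u ++ x :: y :: w := by
  have hlen : n = u.length + (w.length + 2) := by
    have := congrArg List.length h
    simpa using this
  have hget : ∀ k (hk : k < n), I ⟨k, hk⟩ = (u ++ y :: x :: w)[k]'(by simp; omega) := by
    intro k hk
    simp only [← h, List.getElem_ofFn]
  refine ⟨⟨u.length, by omega⟩, ⟨u.length + 1, by omega⟩, rfl, ?_, ?_, ?_⟩
  · rw [hget]; simp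
  · rw [hget]; simp
  · refine List.ext_getElem (by simp; omega) fun k h1 h2 => ?_
    rw [List.getElem_ofFn, Function.comp_apply, Equiv.swap_apply_def]
    split_ifs with h3 h4
    · rw [Fin.mk.injEq] at h3; subst h3; rw [hget]; simp
    · rw [Fin.mk.injEq] at h4; subst h4; rw [hget]; simp
    · rw [Fin.mk.injEq] at h3 h4
      rw [hget]
      rcases lt_or_gt_of_ne h3 with h5 | h5
      · rw [List.getElem_append_left h5, List.getElem_append_left h5]
      · rw [List.getElem_append_right h5.le, List.getElem_append_right h5.le]
        obtain ⟨d, hd⟩ : ∃ d, k - u.length = d + 2 := ⟨k - u.length - 2, by omega⟩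
        simp [hd]

/-- An operator vanishes if it commutes with the nil-Coxeter operators, the rotation and the
projections to the weight subspaces, and has zero diagonal entries. -/
lemma eq_zero_of_commute {B : TOp N (m + 1)} {p : Fin N → ℂ} (hp : p ∈ pDomain N)
    (hnil : ∀ a a' : Fin (m + 1), (a : ℕ) + 1 = a' → Commute (nilOp a a') B)
    (hrot : Commute (rotOp p) B) (hproj : ∀ I, Commute (rearrProj I) B) (hdiag : ∀ J, B J J = 0) :
    B = 0 := by
  have hT : ∀ a a' : Fin (m + 1), (a : ℕ) + 1 = a' → ∀ J I,
      (if J a' < J a then 1 else 0) * B (J ∘ Equiv.swap a a') I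
        = B J (I ∘ Equiv.swap a a') * (if I a < I a' then 1 else 0) := by
    intro a a' haa J I
    have := congrFun (congrFun (hnil a a' haa).eq J) I
    rw [nilOp, mono_mul_apply, mul_mono_apply] at this
    simpa using this
  have hC : ∀ J I, p (J 0) * B (J ∘ finRotate (m + 1)) I
      = B J (I ∘ (finRotate (m + 1)).symm) * p (I ((finRotate (m + 1)).symm 0)) := by
    intro J I
    have := congrFun (congrFun hrot.eq J) I
    rwa [rotOp, mono_mul_apply, mul_mono_apply] at this
  -- All T's kill a weakly decreasing word, hence also its image under B. That image then involves
  -- only weakly decreasing words of the same weight, that is, the word itself, whose coefficient is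
  -- a diagonal entry.
  have hanti : ∀ I, (∀ k : Fin m, I k.succ ≤ I k.castSucc) → ∀ J, B J I = 0 := by
    intro I hI J
    by_contra hne
    have hperm : (List.ofFn J).Perm (List.ofFn I) := by
      by_contra hno
      have := congrFun (congrFun (hproj I).eq J) I
      rw [rearrProj, mono_mul_apply, mul_mono_apply, if_neg hno, zero_mul] at this
      simp only [inv_one, ← Equiv.Perm.inv_def, Equiv.Perm.coe_one, Function.comp_id,
        List.Perm.refl,
        if_true, mul_one] at this
      exact hne this.symm
    have hJ : ∀ k : Fin m, J k.succ ≤ J k.castSucc := by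
      intro k
      by_contra hk
      have := hT k.castSucc k.succ (by simp) (J ∘ Equiv.swap k.castSucc k.succ) I
      rw [if_neg (hI k).not_gt, mul_zero] at this
      have e : (J ∘ Equiv.swap k.castSucc k.succ) ∘ Equiv.swap k.castSucc k.succ = J := by
        ext x; simp
      rw [e] at this
      simp only [Function.comp_apply, Equiv.swap_apply_left, Equiv.swap_apply_right,
        if_pos (not_le.1 hk), one_mul] at this
      exact hne this
    rw [ofFn_antitone_eq hI hJ hperm] at hne
    exact hne (hdiag I)
  -- The words on which B vanishes are closed under rotation (as p has no zeros) and under ascending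
  -- exchanges, hence under all rearrangements.
  let S : List (Fin N) → Prop := fun l => ∀ I : Config N (m + 1), List.ofFn I = l → ∀ J, B J I = 0
  have hS1 : ∀ x u, S (x :: u) → S (u ++ [x]) := by
    intro x u h I hI J
    have h1 := h _ (ofFn_comp_finRotate_symm I hI) (J ∘ (finRotate (m + 1)).symm)
    have h2 := hC (J ∘ (finRotate (m + 1)).symm) I
    rw [h1, zero_mul, mul_eq_zero] at h2
    have e : (J ∘ (finRotate (m + 1)).symm) ∘ finRotate (m + 1) = J := by
      ext x; simp
    rw [e] at h2
    exact h2.resolve_left (hp _)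
  have hS2 : ∀ u x y w, x < y → S (u ++ x :: y :: w) → S (u ++ y :: x :: w) := by
    intro u x y w hxy h I hI J
    obtain ⟨a, a', haa, ha, ha', hsw⟩ := ofFn_comp_swap hI
    have h1 := h _ hsw
    have h2 := hT a a' haa J (I ∘ Equiv.swap a a')
    have e : (I ∘ Equiv.swap a a') ∘ Equiv.swap a a' = I := by
      ext x; simp
    rw [h1, mul_zero, e] at h2
    simpa [ha, ha', hxy] using h2.symm
  ext J I
  -- Sorting read backwards gives the weakly decreasing rearrangement.
  let σ : Equiv.Perm (Fin (m + 1)) := Fin.revPerm.trans (Tuple.sort I)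
  have hσ : S (List.ofFn (I ∘ σ)) := by
    intro I' hI' J
    rw [List.ofFn_injective hI']
    refine hanti _ (fun k => ?_) J
    have := Tuple.monotone_sort I (Fin.rev_le_rev.2 (Fin.castSucc_lt_succ (i := k)).le)
    simpa [σ] using this
  exact closed_under_perm hS1 hS2 (Equiv.Perm.ofFn_comp_perm σ I) hσ I rfl J

lemma exchSum_commute (i k : Fin N) {p : Fin N → ℂ} (hp : p ∈ pDomain N) :
    Commute (exchSum (n := n) i p) (exchSum k p) := by
  rcases n with _ | m
  · have h : ∀ i, exchSum (n := 0) i p = 0 := by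
      intro i
      rw [exchSum_eq]
      simp [exchOp]
    rw [h, h]
  · rw [Commute, SemiconjBy, ← sub_eq_zero]
    refine eq_zero_of_commute hp (fun a a' haa => nilOp_commute_commutator i k p haa) ?_ ?_
      (commutator_apply_self i k p)
    · have h1 := rotOp_commute_exchSum (m := m) i hp
      have h2 := rotOp_commute_exchSum (m := m) k hp
      exact (h1.mul_right h2).sub_right (h2.mul_right h1)
    · intro I
      have h1 := rearrProj_commute_exchSum I i p
      have h2 := rearrProj_commute_exchSum I k p
      exact (h1.mul_right h2).sub_right (h2.mul_right h1)

lemma diagSum_commute (i k : Fin N) (z : Fin n → ℂ) : Commute (diagSum i z) (diagSum k z) :=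
  Commute.sum_left _ _ _ fun a _ => Commute.sum_right _ _ _ fun b _ =>
    ((eOp_commute a b i k).smul_left _).smul_right _

/-- The terms of degree 2 and 0 in z commute separately; the cross terms cancel by `eOp_exchSum` at
each position. -/
lemma Xlim_commute (i k : Fin N) (z : Fin n → ℂ) {p : Fin N → ℂ} (hp : p ∈ pDomain N) :
    Commute (Xlim i z p) (Xlim k z p) := by
  have h1 := (exchSum_commute (n := n) i k hp).eq
  have h2 := (diagSum_commute i k z).eq
  have h3 : diagSum i z * exchSum k p - exchSum k p * diagSum i z
      = diagSum k z * exchSum i p - exchSum i p * diagSum k z := by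
    simp only [diagSum, Finset.sum_mul, Finset.mul_sum, ← Finset.sum_sub_distrib]
    refine Finset.sum_congr rfl fun a _ => ?_
    rw [smul_mul_assoc, mul_smul_comm, ← smul_sub, smul_mul_assoc, mul_smul_comm, ← smul_sub,
      eOp_exchSum]
  rw [Commute, SemiconjBy, Xlim_eq, Xlim_eq, ← sub_eq_zero]
  have : (diagSum i z + exchSum i p) * (diagSum k z + exchSum k p)
      - (diagSum k z + exchSum k p) * (diagSum i z + exchSum i p)
      = (diagSum i z * diagSum k z - diagSum k z * diagSum i z)
        + (exchSum i p * exchSum k p - exchSum k p * exchSum i p)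
        + ((diagSum i z * exchSum k p - exchSum k p * diagSum i z)
        - (diagSum k z * exchSum i p - exchSum i p * diagSum k z)) := by
    noncomm_ring
  rw [this, h1, h2, h3, sub_self, sub_self, sub_self, add_zero, add_zero]

end Commutativity

/-! ### Translations in an affine braid-type monoid -/

section Translations

variable {M : Type*}

/-- The product `s (k - 1) * ⋯ * s 0`. -/
def downProd [Monoid M] (s : ℕ → M) : ℕ → M
  | 0 => 1
  | k + 1 => s k * downProd s k

variable [Monoid M] {m : ℕ} {s : ℕ → M} {c : M} {Z : ℕ → M}

lemma mul_downProd_of_le (hfar : ∀ k l, k + 2 ≤ l → l < m → s k * s l = s l * s k) (j k : ℕ)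
    (hjk : j + 1 ≤ k) (hk : k < m) : s k * downProd s j = downProd s j * s k := by
  induction j with
  | zero => simp [downProd]
  | succ j ih =>
    rw [downProd, ← mul_assoc, ← hfar j k hjk hk, mul_assoc, ih (by omega), mul_assoc]

/-- The descending product acts as a cycle, so passing through it raises the index by one; `c` also
raises it, which is why `s (k + 1)` commutes with `Z 0`. -/
lemma mul_downProd (hbraid : ∀ k, k + 1 < m → s k * s (k + 1) * s k = s (k + 1) * s k * s (k + 1))
    (hfar : ∀ k l, k + 2 ≤ l → l < m → s k * s l = s l * s k) (j k : ℕ) (hjk : k + 2 ≤ j)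
    (hj : j ≤ m) : s k * downProd s j = downProd s j * s (k + 1) := by
  induction j, hjk using Nat.le_induction with
  | base =>
    have h := mul_downProd_of_le hfar k (k + 1) le_rfl (by omega)
    calc s k * downProd s (k + 2) = s k * s (k + 1) * s k * downProd s k := by
          simp only [downProd, mul_assoc]
      _ = s (k + 1) * s k * (s (k + 1) * downProd s k) := by
          rw [hbraid k (by omega), mul_assoc]
      _ = downProd s (k + 2) * s (k + 1) := by
          rw [h]; simp only [downProd, mul_assoc]
  | succ j hj' ih =>
    rw [downProd, ← mul_assoc, hfar k j hj' (by omega), mul_assoc, ih (by omega), mul_assoc]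

lemma commute_translation_zero
    (hbraid : ∀ k, k + 1 < m → s k * s (k + 1) * s k = s (k + 1) * s k * s (k + 1))
    (hfar : ∀ k l, k + 2 ≤ l → l < m → s k * s l = s l * s k)
    (hrot : ∀ k, k + 1 < m → c * s k = s (k + 1) * c) (hZ : Z 0 = c * downProd s m) (k : ℕ)
    (hk1 : k + 1 < m) : Commute (s (k + 1)) (Z 0) := by
  rw [Commute, SemiconjBy, hZ, ← mul_assoc, ← hrot k hk1, mul_assoc,
    mul_downProd hbraid hfar m k hk1 le_rfl, mul_assoc]

lemma commute_translation
    (hbraid : ∀ k, k + 1 < m → s k * s (k + 1) * s k = s (k + 1) * s k * s (k + 1))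
    (hfar : ∀ k l, k + 2 ≤ l → l < m → s k * s l = s l * s k)
    (hrot : ∀ k, k + 1 < m → c * s k = s (k + 1) * c) (hZ : Z 0 = c * downProd s m)
    (hZs : ∀ k, k < m → Z (k + 1) = s k * Z k * s k) (b : ℕ) :
    b ≤ m → ∀ k, k < m → k ≠ b → k + 1 ≠ b → Commute (s k) (Z b) := by
  induction b using Nat.strong_induction_on with
  | _ b ih =>
    intro hb k hk hkb hkb1
    rcases b with _ | b
    · obtain ⟨k, rfl⟩ := Nat.exists_eq_succ_of_ne_zero hkb
      exact commute_translation_zero hbraid hfar hrot hZ k hk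
    · rw [hZs b (by omega)]
      by_cases hk1 : k + 1 = b
      · subst hk1
        have h1 := hbraid k (by omega)
        have h2 := (ih k (by omega) (by omega) (k + 1) (by omega) (by omega) (by omega)).eq
        rw [hZs k hk, Commute, SemiconjBy]
        calc s k * (s (k + 1) * (s k * Z k * s k) * s (k + 1))
            = s k * s (k + 1) * s k * Z k * s k * s (k + 1) := by simp only [mul_assoc]
          _ = s (k + 1) * s k * (s (k + 1) * Z k) * s k * s (k + 1) := by
              rw [h1]; simp only [mul_assoc]
          _ = s (k + 1) * s k * Z k * (s (k + 1) * s k * s (k + 1)) := by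
              rw [h2]; simp only [mul_assoc]
          _ = s (k + 1) * (s k * Z k * s k) * s (k + 1) * s k := by
              rw [← h1]; simp only [mul_assoc]
      · have h1 : Commute (s k) (s b) := by
          rcases lt_or_gt_of_ne (show k ≠ b by omega) with h | h
          · exact hfar k b (by omega) (by omega)
          · exact (hfar b k (by omega) hk).symm
        have h2 := ih b (by omega) (by omega) k hk (by omega) hk1
        exact (h1.mul_right h2).mul_right h1

lemma mul_ascending_downProd
    (hbraid : ∀ k, k + 1 < m → s k * s (k + 1) * s k = s (k + 1) * s k * s (k + 1))
    (hfar : ∀ k l, k + 2 ≤ l → l < m → s k * s l = s l * s k) (j : ℕ) (hj : j < m) :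
    downProd s m * downProd (fun k => s (k + 1)) j = downProd s j * downProd s m := by
  induction j with
  | zero => simp [downProd]
  | succ j ih =>
    simp only [downProd]
    rw [← mul_assoc, ← mul_downProd hbraid hfar m j hj le_rfl, mul_assoc, ih (by omega), mul_assoc]

lemma downProd_succ_eq (s : ℕ → M) (j : ℕ) :
    downProd s (j + 1) = downProd (fun k => s (k + 1)) j * s 0 := by
  induction j with
  | zero => simp [downProd]
  | succ j ih => rw [downProd, ih, downProd, mul_assoc]

lemma rot_mul_downProd (hrot : ∀ k, k + 1 < m → c * s k = s (k + 1) * c) (j : ℕ) (hj : j < m) :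
    c * downProd s j = downProd (fun k => s (k + 1)) j * c := by
  induction j with
  | zero => simp [downProd]
  | succ j ih =>
    simp only [downProd]
    rw [← mul_assoc, hrot j hj, mul_assoc, ih (by omega), mul_assoc]

/-- The only place where `c * c` enters: both products reduce to words in c² and descending
products, and `hrot2` carries the last generator around the end. Neither `c` nor the translations
are inverted. -/
lemma commute_translation_zero_one (hsq : ∀ k, k < m → s k * s k = 1)
    (hbraid : ∀ k, k + 1 < m → s k * s (k + 1) * s k = s (k + 1) * s k * s (k + 1))
    (hfar : ∀ k l, k + 2 ≤ l → l < m → s k * s l = s l * s k)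
    (hrot : ∀ k, k + 1 < m → c * s k = s (k + 1) * c)
    (hrot2 : ∀ k, k + 1 = m → c * c * s k = s 0 * (c * c)) (hm : 0 < m)
    (hZ : Z 0 = c * downProd s m) (hZs : ∀ k, k < m → Z (k + 1) = s k * Z k * s k) :
    Commute (Z 0) (Z 1) := by
  obtain ⟨m, rfl⟩ := Nat.exists_eq_succ_of_ne_zero hm.ne'
  have h0 := hsq 0 hm
  set e := downProd (fun k => s (k + 1)) m with he
  set D := downProd s (m + 1) with hD
  set d := downProd s m with hd
  have hDe : D = e * s 0 := downProd_succ_eq s m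
  have hDs : D * s 0 = e := by rw [hDe, mul_assoc, h0, mul_one]
  have hDd : D = s m * d := rfl
  have hce : c * d = e * c := rot_mul_downProd hrot m (by omega)
  have hDe2 : D * e = d * D := mul_ascending_downProd hbraid hfar m (by omega)
  have h2 := hrot2 m rfl
  rw [Commute, SemiconjBy, hZs 0 hm, hZ]
  calc c * D * (s 0 * (c * D) * s 0) = c * (D * s 0) * (c * (D * s 0)) := by simp only [mul_assoc]
    _ = c * (e * c) * e := by rw [hDs]; simp only [mul_assoc]
    _ = c * c * (d * e) := by rw [← hce]; simp only [mul_assoc]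
    _ = c * c * (d * (D * s 0)) := by rw [hDs]
    _ = c * c * (D * D) := by rw [← mul_assoc d, ← hDe2, mul_assoc D e, ← hDe]
    _ = c * c * s m * (d * D) := by rw [hDd]; simp only [mul_assoc]
    _ = s 0 * (c * (c * d)) * D := by rw [h2]; simp only [mul_assoc]
    _ = s 0 * (c * (e * c)) * D := by rw [hce]
    _ = s 0 * (c * (D * s 0 * c)) * D := by rw [hDs]
    _ = s 0 * (c * D) * s 0 * (c * D) := by simp only [mul_assoc]

/-- The translations of an affine symmetric group commute. -/
lemma commute_translations (hsq : ∀ k, k < m → s k * s k = 1)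
    (hbraid : ∀ k, k + 1 < m → s k * s (k + 1) * s k = s (k + 1) * s k * s (k + 1))
    (hfar : ∀ k l, k + 2 ≤ l → l < m → s k * s l = s l * s k)
    (hrot : ∀ k, k + 1 < m → c * s k = s (k + 1) * c)
    (hrot2 : ∀ k, k + 1 = m → c * c * s k = s 0 * (c * c))
    (hZ : Z 0 = c * downProd s m) (hZs : ∀ k, k < m → Z (k + 1) = s k * Z k * s k)
    {a b : ℕ} (ha : a ≤ m) (hb : b ≤ m) : Commute (Z a) (Z b) := by
  have h0 : ∀ b, b + 1 ≤ m → Commute (Z 0) (Z (b + 1)) := by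
    intro b hb
    induction b with
    | zero => exact commute_translation_zero_one hsq hbraid hfar hrot hrot2 hb hZ hZs
    | succ b ih =>
      have h1 := (commute_translation_zero hbraid hfar hrot hZ b hb).symm
      rw [hZs (b + 1) hb]
      exact (h1.mul_right (ih (by omega))).mul_right h1
  have hlt : ∀ a b, a < b → b ≤ m → Commute (Z a) (Z b) := by
    intro a b hab hb
    induction a with
    | zero =>
      obtain ⟨b, rfl⟩ := Nat.exists_eq_succ_of_ne_zero hab.ne'
      exact h0 b hb
    | succ a ih =>
      have h1 := commute_translation hbraid hfar hrot hZ hZs b hb a (by omega) (by omega) (by omega)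
      rw [hZs a (by omega)]
      exact (h1.mul_left (ih (by omega))).mul_left h1
  rcases lt_trichotomy a b with h | rfl | h
  · exact hlt a b h hb
  · exact Commute.refl _
  · exact (hlt b a h ha).symm

end Translations

/-! ### The braid relations -/

section Braid

variable {N n m : ℕ}

lemma nilOp_mul_self (a a' : Fin n) : nilOp a a' * nilOp a a' = (0 : TOp N n) := by
  rw [nilOp, mono_mul_mono]
  refine mono_eq_zero _ fun J => ?_
  rw [ite_zero_mul_ite_zero, if_neg]
  simp only [Function.comp_apply, Equiv.swap_apply_left, Equiv.swap_apply_right]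
  exact fun h => h.1.not_gt h.2

/-- Both sides reverse three strictly monotone labels and kill every other word. -/
lemma nilOp_braid {a b c : Fin n} (hab : a ≠ b) (hac : a ≠ c) (hbc : b ≠ c) :
    nilOp a b * nilOp b c * nilOp a b = (nilOp b c * nilOp a b * nilOp b c : TOp N n) := by
  simp only [nilOp, mono_mul_mono]
  have hσ : Equiv.swap a b * Equiv.swap b c * Equiv.swap a b
      = Equiv.swap b c * Equiv.swap a b * Equiv.swap b c := by
    ext x
    simp only [Equiv.Perm.mul_apply, Equiv.swap_apply_def]
    grind
  rw [hσ]
  refine mono_congr _ fun J => ?_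
  rw [ite_zero_mul_ite_zero, ite_zero_mul_ite_zero, ite_zero_mul_ite_zero, ite_zero_mul_ite_zero]
  refine ite_eq_ite_of_iff ?_ _ _
  simp only [Function.comp_apply, Equiv.Perm.mul_apply, Equiv.swap_apply_def]
  grind

lemma nilOp_far {a b c d : Fin n} (hac : a ≠ c) (had : a ≠ d) (hbc : b ≠ c) (hbd : b ≠ d) :
    Commute (nilOp a b) (nilOp c d : TOp N n) := by
  rw [Commute, SemiconjBy, nilOp, nilOp, mono_mul_mono, mono_mul_mono]
  have hσ : Equiv.swap a b * Equiv.swap c d = Equiv.swap c d * Equiv.swap a b := by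
    ext x
    simp only [Equiv.Perm.mul_apply, Equiv.swap_apply_def]
    grind
  rw [hσ]
  refine mono_congr _ fun J => ?_
  rw [ite_zero_mul_ite_zero, ite_zero_mul_ite_zero]
  refine ite_eq_ite_of_iff ?_ _ _
  simp only [Function.comp_apply, Equiv.swap_apply_def]
  grind

lemma braidOp_mul_neg (a a' : Fin n) {u v : ℂ} (huv : u + v = 0) :
    braidOp a a' u * braidOp a a' v = (1 : TOp N n) := by
  have h := nilOp_mul_self (N := N) a a'
  obtain rfl : v = -u := by linear_combination huv
  simp only [braidOp, add_mul, mul_add, one_mul, mul_one, smul_mul_assoc, mul_smul_comm, h,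
    smul_zero]
  module

/-- The Yang–Baxter equation in the braid form. -/
lemma braidOp_yangBaxter {a b c : Fin n} (hab : a ≠ b) (hac : a ≠ c) (hbc : b ≠ c) {u v w : ℂ}
    (h : w = u + v) :
    braidOp a b u * braidOp b c w * braidOp a b v
      = (braidOp b c v * braidOp a b w * braidOp b c u : TOp N n) := by
  subst h
  have h1 := nilOp_mul_self (N := N) a b
  have h2 := nilOp_mul_self (N := N) b c
  have h3 := nilOp_braid (N := N) hab hac hbc
  simp only [braidOp]
  generalize nilOp a b = A at *
  generalize nilOp b c = B at *
  simp only [add_mul, mul_add, one_mul, mul_one, smul_mul_assoc, mul_smul_comm, h1, h2, h3,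
    smul_zero, add_zero]
  module

lemma braidOp_far {a b c d : Fin n} (hac : a ≠ c) (had : a ≠ d) (hbc : b ≠ c) (hbd : b ≠ d)
    (u v : ℂ) : Commute (braidOp a b u) (braidOp c d v : TOp N n) :=
  (Commute.one_left _).add_left (((Commute.one_right _).add_right
    ((nilOp_far hac had hbc hbd).smul_right v)).smul_left u)

lemma rotOp_mul_nilOp (p : Fin N → ℂ) {a a' : Fin (m + 1)}
    (h : finRotate (m + 1) a ≠ 0) (h' : finRotate (m + 1) a' ≠ 0) :
    rotOp p * nilOp a a' = nilOp (finRotate (m + 1) a) (finRotate (m + 1) a') * rotOp p := by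
  rw [rotOp, nilOp, nilOp, mono_mul_mono, mono_mul_mono, Equiv.mul_swap_eq_swap_mul]
  refine mono_congr _ fun J => ?_
  simp only [Function.comp_apply, Equiv.swap_apply_of_ne_of_ne h.symm h'.symm]
  rw [mul_comm]

/-- One rotation would tear the last pair apart; two carry it to the first pair, and the twist is
then a product over both positions, symmetric under their exchange. -/
lemma rotOp_mul_rotOp_mul_nilOp (p : Fin N → ℂ) {a a' : Fin (m + 1)} (ha' : a' = Fin.last m)
    (haa : (a : ℕ) + 1 = a') :
    rotOp p * rotOp p * nilOp a a' = nilOp (finRotate (m + 1) (finRotate (m + 1) a))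
      (finRotate (m + 1) (finRotate (m + 1) a')) * (rotOp p * rotOp p) := by
  simp only [rotOp, nilOp, mono_mul_mono, Equiv.mul_swap_eq_swap_mul, Equiv.Perm.mul_apply]
  refine mono_congr _ fun J => ?_
  have h1 : finRotate (m + 1) a' = 0 := by rw [ha', finRotate_last]
  have h2 : finRotate (m + 1) a = a' := by
    ext
    rw [coe_finRotate_of_ne_last, haa]
    rw [ne_eq, Fin.ext_iff, Fin.val_last]
    rw [Fin.ext_iff, Fin.val_last] at ha'
    omega
  simp only [Function.comp_apply, Equiv.Perm.mul_apply, h1, h2]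
  rw [Equiv.swap_apply_left, Equiv.swap_apply_right]
  ring

lemma rotOp_mul_braidOp (p : Fin N → ℂ) {a a' : Fin (m + 1)}
    (h : finRotate (m + 1) a ≠ 0) (h' : finRotate (m + 1) a' ≠ 0) (u : ℂ) :
    rotOp p * braidOp a a' u
      = braidOp (finRotate (m + 1) a) (finRotate (m + 1) a') u * rotOp p := by
  rw [braidOp, braidOp, mul_add, add_mul, mul_smul_comm, smul_mul_assoc, rotOp_mul_nilOp p h h',
    mul_one, one_mul]

lemma rotOp_mul_rotOp_mul_braidOp (p : Fin N → ℂ) {a a' : Fin (m + 1)} (ha' : a' = Fin.last m)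
    (haa : (a : ℕ) + 1 = a') (u : ℂ) :
    rotOp p * rotOp p * braidOp a a' u = braidOp (finRotate (m + 1) (finRotate (m + 1) a))
      (finRotate (m + 1) (finRotate (m + 1) a')) u * (rotOp p * rotOp p) := by
  rw [braidOp, braidOp, mul_add, add_mul, mul_smul_comm, smul_mul_assoc,
    rotOp_mul_rotOp_mul_nilOp p ha' haa, mul_one, one_mul]

end Braid

/-! ### The qKZ operators through braid operators -/

section QKZ

variable {N n m : ℕ}

/-- The operator `R°(u)` on the factors `a`, `b`. -/
def rOp (a b : Fin n) (u : ℂ) : TOp N n := actTwo a b (Rlim N u)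

/-- The permutation of the tensor factors. -/
def permOp (σ : Equiv.Perm (Fin n)) : TOp N n := mono σ fun _ => 1

lemma permOp_mul (σ τ : Equiv.Perm (Fin n)) : permOp σ * permOp τ = (permOp (σ * τ) : TOp N n) := by
  rw [permOp, permOp, mono_mul_mono, permOp]
  simp

lemma permOp_one : (permOp 1 : TOp N n) = 1 := mono_one

lemma rOp_eq_braidOp_mul {a a' : Fin n} (h : a ≠ a') (u : ℂ) :
    rOp a' a u = (braidOp a a' u * permOp (Equiv.swap a a') : TOp N n) := by
  rw [rOp, actTwo_Rlim h.symm, braidOp, add_mul, one_mul, smul_mul_assoc, nilOp, permOp,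
    mono_mul_mono, Equiv.swap_mul_self, smul_mono, Equiv.swap_comm]
  congr 1
  exact mono_congr _ fun J => by simp

lemma rOp_eq_mul_braidOp {a a' : Fin n} (h : a ≠ a') (u : ℂ) :
    rOp a a' u = (permOp (Equiv.swap a a') * braidOp a a' u : TOp N n) := by
  rw [rOp, actTwo_Rlim h, braidOp, mul_add, mul_one, mul_smul_comm, nilOp, permOp,
    mono_mul_mono, Equiv.swap_mul_self, smul_mono]
  congr 1
  exact mono_congr _ fun J => by simp

lemma permOp_mul_rOp (σ : Equiv.Perm (Fin n)) {a b : Fin n} (h : a ≠ b) (u : ℂ) :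
    SemiconjBy (permOp σ) (rOp a b u) (rOp (σ a) (σ b) u : TOp N n) := by
  have h' : σ a ≠ σ b := by simpa using h
  rw [SemiconjBy, rOp, rOp, actTwo_Rlim h, actTwo_Rlim h', permOp, mul_add, add_mul,
    mono_mul_mono, mono_mul_mono, mono_mul_mono, mono_mul_mono, Equiv.mul_swap_eq_swap_mul,
    mul_one, one_mul]
  congr 1
  exact mono_congr _ fun J => by simp

lemma permOp_mul_pPow (σ : Equiv.Perm (Fin n)) (a : Fin n) (p : Fin N → ℂ) :
    SemiconjBy (permOp σ) (pPow a p) (pPow (σ a) p) := by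
  rw [SemiconjBy, pPow_eq, pPow_eq, permOp, mono_mul_mono, mono_mul_mono, mul_one, one_mul]
  exact mono_congr _ fun J => by simp

lemma semiconjBy_prod_map {M ι : Type*} [Monoid M] (x : M) (l : List ι) (f g : ι → M)
    (h : ∀ b ∈ l, SemiconjBy x (f b) (g b)) :
    SemiconjBy x (l.map f).prod (l.map g).prod := by
  induction l with
  | nil => simp
  | cons b l ih =>
    rw [List.map_cons, List.prod_cons, List.map_cons, List.prod_cons]
    exact (h b (by simp)).mul_right (ih fun c hc => h c (by simp [hc]))

lemma filter_reverse_finRange_ext {l : List (Fin n)} {P : Fin n → Bool}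
    (hl : l.Pairwise (fun x y => y < x)) (h : ∀ x, x ∈ l ↔ P x = true) :
    (List.finRange n).reverse.filter P = l := by
  have h1 : ((List.finRange n).reverse.filter P).Pairwise (fun x y => y < x) :=
    (List.pairwise_reverse.2 (List.pairwise_lt_finRange n)).filter _
  refine List.Perm.eq_of_pairwise (fun a b _ _ h1 h2 => absurd h1 h2.not_gt) h1 hl ?_
  refine (List.perm_ext_iff_of_nodup (h1.imp fun h => h.ne') (hl.imp fun h => h.ne')).2 fun x => ?_
  rw [h]
  simp

lemma filter_lt_succ {a a' : Fin n} (haa : (a : ℕ) + 1 = a') :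
    (List.finRange n).reverse.filter (fun b => b < a')
      = a :: (List.finRange n).reverse.filter (fun b => b < a) := by
  refine filter_reverse_finRange_ext ?_ ?_
  · rw [List.pairwise_cons]
    refine ⟨fun b hb => by simpa using hb, ?_⟩
    exact (List.pairwise_reverse.2 (List.pairwise_lt_finRange n)).filter _
  · intro x
    simp only [List.mem_cons, List.mem_filter, List.mem_reverse, List.mem_finRange, true_and,
      decide_eq_true_eq, Fin.lt_def, Fin.ext_iff]
    omega

lemma filter_succ_lt {a a' : Fin n} (haa : (a : ℕ) + 1 = a') :
    (List.finRange n).reverse.filter (fun b => a < b)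
      = (List.finRange n).reverse.filter (fun b => a' < b) ++ [a'] := by
  refine filter_reverse_finRange_ext ?_ ?_
  · rw [List.pairwise_append]
    refine ⟨(List.pairwise_reverse.2 (List.pairwise_lt_finRange n)).filter _, by simp, ?_⟩
    intro x hx y hy
    rw [List.mem_singleton.1 hy]
    simpa using hx
  · intro x
    simp only [List.mem_append, List.mem_filter, List.mem_reverse, List.mem_finRange, true_and,
      decide_eq_true_eq, Fin.lt_def, List.mem_singleton, Fin.ext_iff]
    omega

/-- Passing from a to a+1 turns the rightmost R-factor of one operator into the leftmost of the
other. The transposition P inside the new factor intertwines all remaining factors. -/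
lemma Klim_succ (κ : ℂ) {a a' : Fin n} (haa : (a : ℕ) + 1 = a') (z : Fin n → ℂ)
    (p : Fin N → ℂ) :
    Klim κ a' z p = braidOp a a' (z a' - z a + κ) * Klim κ a (z ∘ Equiv.swap a a') p
      * braidOp a a' (z a - z a') := by
  have hne : a ≠ a' := by rintro rfl; omega
  set l₁ := (List.finRange n).reverse.filter (fun b => b < a) with hl₁
  set l₂ := (List.finRange n).reverse.filter (fun b => a' < b) with hl₂
  have hm₁ : ∀ b ∈ l₁, b ≠ a ∧ b ≠ a' := by
    intro b hb
    simp only [hl₁, List.mem_filter, decide_eq_true_eq, Fin.lt_def] at hb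
    constructor <;> rintro rfl <;> omega
  have hm₂ : ∀ b ∈ l₂, b ≠ a ∧ b ≠ a' := by
    intro b hb
    simp only [hl₂, List.mem_filter, decide_eq_true_eq, Fin.lt_def] at hb
    constructor <;> rintro rfl <;> omega
  have hz : ∀ b, b ≠ a ∧ b ≠ a' → (z ∘ Equiv.swap a a') b = z b := fun b hb => by
    rw [Function.comp_apply, Equiv.swap_apply_of_ne_of_ne hb.1 hb.2]
  have hs : ∀ b, b ≠ a ∧ b ≠ a' → ∀ u, SemiconjBy (permOp (Equiv.swap a a'))
      (rOp a b u) (rOp a' b u : TOp N n) := by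
    intro b hb u
    have := permOp_mul_rOp (N := N) (Equiv.swap a a') hb.1.symm u
    rwa [Equiv.swap_apply_left, Equiv.swap_apply_of_ne_of_ne hb.1 hb.2] at this
  have hL : Klim κ a' z p = rOp a' a (z a' - z a + κ)
      * (l₁.map fun b => rOp a' b (z a' - z b + κ)).prod * pPow a' p
      * (l₂.map fun b => rOp a' b (z a' - z b)).prod := by
    rw [Klim, filter_lt_succ haa, List.map_cons, List.prod_cons]
    rfl
  have hR : Klim κ a (z ∘ Equiv.swap a a') p
      = (l₁.map fun b => rOp a b (z a' - z b + κ)).prod * pPow a p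
      * ((l₂.map fun b => rOp a b (z a' - z b)).prod * rOp a a' (z a' - z a)) := by
    rw [Klim, filter_succ_lt haa, List.map_append, List.prod_append, List.map_singleton,
      List.prod_singleton]
    have e1 : (l₁.map fun b => rOp a b (z a' - z b + κ) : List (TOp N n)) = l₁.map fun b =>
        actTwo a b (Rlim N ((z ∘ Equiv.swap a a') a - (z ∘ Equiv.swap a a') b + κ)) := by
      refine List.map_congr_left fun b hb => ?_
      rw [hz b (hm₁ b hb), Function.comp_apply, Equiv.swap_apply_left, rOp]
    have e2 : (l₂.map fun b => rOp a b (z a' - z b) : List (TOp N n)) = l₂.map fun b =>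
        actTwo a b (Rlim N ((z ∘ Equiv.swap a a') a - (z ∘ Equiv.swap a a') b)) := by
      refine List.map_congr_left fun b hb => ?_
      rw [hz b (hm₂ b hb), Function.comp_apply, Equiv.swap_apply_left, rOp]
    rw [e1, e2, Function.comp_apply, Function.comp_apply, Equiv.swap_apply_left,
      Equiv.swap_apply_right]
    rfl
  have hc1 := semiconjBy_prod_map (permOp (Equiv.swap a a')) l₁
    (fun b => rOp a b (z a' - z b + κ)) (fun b => (rOp a' b (z a' - z b + κ) : TOp N n))
    fun b hb => hs b (hm₁ b hb) _
  have hc2 := semiconjBy_prod_map (permOp (Equiv.swap a a')) l₂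
    (fun b => rOp a b (z a' - z b)) (fun b => (rOp a' b (z a' - z b) : TOp N n))
    fun b hb => hs b (hm₂ b hb) _
  have hc3 := permOp_mul_pPow (Equiv.swap a a') a p
  rw [Equiv.swap_apply_left] at hc3
  have hc := ((hc1.mul_right hc3).mul_right hc2).eq
  -- The braid operator on the right cancels the one in the last R-factor of K_a and leaves P.
  have hu : braidOp a a' (z a' - z a) * braidOp a a' (z a - z a') = (1 : TOp N n) :=
    braidOp_mul_neg a a' (by ring)
  have hP : permOp (Equiv.swap a a') * permOp (Equiv.swap a a') = (1 : TOp N n) := by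
    rw [permOp_mul, Equiv.swap_mul_self, permOp_one]
  rw [hL, hR, rOp_eq_braidOp_mul hne, rOp_eq_mul_braidOp hne]
  generalize (List.map (fun b => rOp a b (z a' - z b + κ)) l₁).prod = L at *
  generalize (List.map (fun b => rOp a' b (z a' - z b + κ)) l₁).prod = L' at *
  generalize (List.map (fun b => rOp a b (z a' - z b)) l₂).prod = U at *
  generalize (List.map (fun b => rOp a' b (z a' - z b)) l₂).prod = U' at *
  generalize permOp (Equiv.swap a a') = P at *
  calc braidOp a a' (z a' - z a + κ) * P * L' * pPow a' p * U'
      = braidOp a a' (z a' - z a + κ) * P * (L' * pPow a' p * U' * (P * P)) := by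
        rw [hP, mul_one]; simp only [mul_assoc]
    _ = braidOp a a' (z a' - z a + κ) * (P * P) * (L * pPow a p * U) * P := by
        rw [← mul_assoc _ P P, ← hc]; simp only [mul_assoc]
    _ = braidOp a a' (z a' - z a + κ) * (L * pPow a p * U) * P
          * (braidOp a a' (z a' - z a) * braidOp a a' (z a - z a')) := by
        rw [hP, hu, mul_one, mul_one]
    _ = _ := by simp only [mul_assoc]

/-- The position with number `k`. -/
def pos (m k : ℕ) : Fin (m + 1) := Fin.ofNat (m + 1) k

lemma pos_val {k : ℕ} (hk : k ≤ m) : (pos m k : ℕ) = k :=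
  Nat.mod_eq_of_lt (Nat.lt_succ_of_le hk)

lemma pos_zero : pos m 0 = 0 := rfl

lemma pos_coe (a : Fin (m + 1)) : pos m a = a := Fin.ext (pos_val (Nat.lt_succ_iff.1 a.2))

/-- The cyclic permutation of the positions `0, …, k`. -/
def cycUpTo (m : ℕ) : ℕ → Equiv.Perm (Fin (m + 1))
  | 0 => 1
  | k + 1 => cycUpTo m k * Equiv.swap (pos m k) (pos m (k + 1))

lemma cycUpTo_apply {k : ℕ} (hk : k ≤ m) (j : Fin (m + 1)) : (cycUpTo m k j : ℕ)
    = if (j : ℕ) < k then (j : ℕ) + 1 else if (j : ℕ) = k then 0 else (j : ℕ) := by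
  induction k generalizing j with
  | zero =>
    simp only [cycUpTo, Equiv.Perm.coe_one, id_eq]
    split_ifs <;> omega
  | succ k ih =>
    have h1 := pos_val (m := m) (k := k) (by omega)
    have h2 := pos_val hk
    rw [cycUpTo, Equiv.Perm.mul_apply, ih (by omega), Equiv.swap_apply_def]
    simp only [Fin.ext_iff, h1, h2]
    split_ifs <;> simp_all <;> omega

lemma cycUpTo_eq_finRotate : cycUpTo m m = finRotate (m + 1) := by
  ext j
  rw [cycUpTo_apply le_rfl, coe_finRotate]
  simp only [Fin.ext_iff, Fin.val_last]
  have := j.2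
  split_ifs <;> omega

/-- The product of the braid operators that move the first factor to the position `k`. -/
def braidProd (z : Fin (m + 1) → ℂ) : ℕ → TOp N (m + 1)
  | 0 => 1
  | k + 1 => braidOp (pos m k) (pos m (k + 1)) (z 0 - z (pos m (k + 1))) * braidProd z k

/-- Each R-factor is a transposition times a braid operator. Pulling the transpositions to the left
assembles a cycle and makes the braid operators act on neighbours. -/
lemma prod_rOp_zero (z : Fin (m + 1) → ℂ) {k : ℕ} (hk : k ≤ m) :
    ((List.range k).reverse.map fun b => rOp 0 (pos m (b + 1)) (z 0 - z (pos m (b + 1)))).prod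
      = (permOp (cycUpTo m k) * braidProd z k : TOp N (m + 1)) := by
  induction k with
  | zero => simp [cycUpTo, braidProd, permOp_one]
  | succ k ih =>
    rw [List.range_succ, List.reverse_append, List.reverse_singleton, List.singleton_append,
      List.map_cons, List.prod_cons, ih (by omega), braidProd, cycUpTo, ← permOp_mul]
    have h1 := pos_val (m := m) (k := k) (by omega)
    have h2 := pos_val hk
    have hne : pos m k ≠ pos m (k + 1) := by rw [ne_eq, Fin.ext_iff]; omega
    have h := permOp_mul_rOp (N := N) (cycUpTo m k) hne (z 0 - z (pos m (k + 1)))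
    have e1 : cycUpTo m k (pos m k) = 0 := by
      ext
      rw [cycUpTo_apply (by omega), h1]
      simp
    have e2 : cycUpTo m k (pos m (k + 1)) = pos m (k + 1) := by
      ext
      rw [cycUpTo_apply (by omega), h2]
      split_ifs <;> omega
    rw [e1, e2] at h
    rw [← mul_assoc, ← h.eq, rOp_eq_mul_braidOp hne]
    simp only [mul_assoc]

lemma filter_zero_lt : (List.finRange (m + 1)).reverse.filter (fun b => 0 < b)
    = (List.range m).reverse.map fun b => pos m (b + 1) := by
  refine filter_reverse_finRange_ext ?_ ?_
  · rw [List.pairwise_map, List.pairwise_reverse]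
    refine List.pairwise_lt_range.imp_of_mem fun {a b} ha hb hab => ?_
    rw [List.mem_range] at ha hb
    rw [Fin.lt_def, pos_val (by omega), pos_val (by omega)]
    omega
  · intro x
    simp only [List.mem_map, List.mem_reverse, List.mem_range, decide_eq_true_eq]
    constructor
    · rintro ⟨a, ha, rfl⟩
      rw [Fin.lt_def, pos_val (by omega)]
      simp
    · intro hx
      rw [Fin.lt_def, Fin.val_zero] at hx
      have := x.2
      refine ⟨x - 1, by omega, ?_⟩
      ext
      rw [pos_val (by omega)]
      omega

lemma Klim_zero (κ : ℂ) (z : Fin (m + 1) → ℂ) (p : Fin N → ℂ) :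
    Klim κ 0 z p = rotOp p * braidProd z m := by
  have h1 : (List.finRange (m + 1)).reverse.filter (fun b => b < 0) = [] :=
    filter_reverse_finRange_ext (by simp) (by simp)
  rw [Klim, h1, filter_zero_lt, List.map_map, List.map_nil, List.prod_nil, one_mul]
  have h2 := prod_rOp_zero (N := N) z (le_refl m)
  have h3 : rotOp p = pPow 0 p * permOp (finRotate (m + 1)) := by
    rw [pPow_eq, permOp, mono_mul_mono, one_mul, rotOp]
    exact mono_congr _ fun J => by simp
  rw [h3, mul_assoc, ← cycUpTo_eq_finRotate, ← h2]
  rfl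

end QKZ

/-! ### The difference operators -/

section Difference

variable {N n m : ℕ}

/-- The operator `f ↦ (z ↦ A z (f (g z)))` on functions of `z`. -/
def funOp (g : (Fin n → ℂ) → (Fin n → ℂ)) (A : (Fin n → ℂ) → TOp N n) :
    Module.End ℂ ((Fin n → ℂ) → TSpace N n) where
  toFun f := fun z => A z *ᵥ f (g z)
  map_add' f f' := by
    ext z : 1
    exact Matrix.mulVec_add _ _ _
  map_smul' r f := by
    ext z : 1
    exact Matrix.mulVec_smul (A z) r (f (g z))

lemma funOp_apply (g : (Fin n → ℂ) → (Fin n → ℂ)) (A : (Fin n → ℂ) → TOp N n)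
    (f : (Fin n → ℂ) → TSpace N n) (z : Fin n → ℂ) : funOp g A f z = A z *ᵥ f (g z) := rfl

lemma funOp_mul (g h : (Fin n → ℂ) → (Fin n → ℂ)) (A B : (Fin n → ℂ) → TOp N n) :
    funOp g A * funOp h B = funOp (fun z => h (g z)) fun z => A z * B (g z) := by
  refine LinearMap.ext fun f => funext fun z => ?_
  rw [Module.End.mul_apply, funOp_apply, funOp_apply, funOp_apply, Matrix.mulVec_mulVec]

lemma funOp_congr {g h : (Fin n → ℂ) → (Fin n → ℂ)} {A B : (Fin n → ℂ) → TOp N n}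
    (h1 : ∀ z, g z = h z) (h2 : ∀ z, A z = B z) : funOp g A = funOp h B := by
  rw [funext h1, funext h2]

lemma funOp_one : funOp (fun z => z) (fun _ => 1)
    = (1 : Module.End ℂ ((Fin n → ℂ) → TSpace N n)) := by
  refine LinearMap.ext fun f => funext fun z => ?_
  rw [funOp_apply, Matrix.one_mulVec]
  rfl

/-- The braid operator of the positions `k`, `k + 1` on functions of `z`. -/
def reflFun (N m k : ℕ) : Module.End ℂ ((Fin (m + 1) → ℂ) → TSpace N (m + 1)) :=
  funOp (fun z => z ∘ Equiv.swap (pos m k) (pos m (k + 1)))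
    fun z => braidOp (pos m k) (pos m (k + 1)) (z (pos m (k + 1)) - z (pos m k))

/-- The point `(z_2, …, z_n, z_1 - κ)`. -/
def rotArg (κ : ℂ) (z : Fin (m + 1) → ℂ) : Fin (m + 1) → ℂ :=
  fun j => z (finRotate (m + 1) j) - if j = Fin.last m then κ else 0

/-- The rotation on functions of `z`. -/
def rotFun (κ : ℂ) (p : Fin N → ℂ) : Module.End ℂ ((Fin (m + 1) → ℂ) → TSpace N (m + 1)) :=
  funOp (rotArg κ) fun _ => rotOp p

/-- The qKZ difference operator on functions of `z`. -/
def qkzFun (κ : ℂ) (p : Fin N → ℂ) (a : Fin n) : Module.End ℂ ((Fin n → ℂ) → TSpace N n) :=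
  funOp (shift (-κ) a) fun z => Klim κ a (shift (-κ) a z) p

/-- The dynamical operator on functions of `z`. -/
def dynFun (i : Fin N) (p : Fin N → ℂ) : Module.End ℂ ((Fin n → ℂ) → TSpace N n) :=
  funOp (fun z => z) fun z => Xlim i z p

lemma finRotate_pos {k : ℕ} (hk : k < m) : finRotate (m + 1) (pos m k) = pos m (k + 1) := by
  ext
  rw [coe_finRotate_of_ne_last, pos_val hk, pos_val hk.le]
  rw [ne_eq, Fin.ext_iff, Fin.val_last, pos_val hk.le]
  exact hk.ne

lemma pos_last : pos m m = Fin.last m := Fin.ext (pos_val le_rfl)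

lemma pos_ne_last {k : ℕ} (hk : k < m) : pos m k ≠ Fin.last m := by
  rw [ne_eq, Fin.ext_iff, Fin.val_last, pos_val hk.le]
  exact hk.ne

lemma finRotate_pos_last : finRotate (m + 1) (pos m m) = pos m 0 := by
  rw [pos_last, finRotate_last, pos_zero]

lemma pos_ne {k l : ℕ} (hk : k ≤ m) (hl : l ≤ m) (h : k ≠ l) : pos m k ≠ pos m l := by
  rw [ne_eq, Fin.ext_iff, pos_val hk, pos_val hl]
  exact h

lemma reflFun_mul_self {k : ℕ} (_hk : k < m) : reflFun N m k * reflFun N m k = 1 := by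
  rw [reflFun, funOp_mul, ← funOp_one]
  refine funOp_congr (fun z => ?_) fun z => ?_
  · ext x; simp
  · simp only [Function.comp_apply, Equiv.swap_apply_left, Equiv.swap_apply_right]
    exact braidOp_mul_neg _ _ (by ring)

lemma reflFun_braid {k : ℕ} (hk : k + 1 < m) :
    reflFun N m k * reflFun N m (k + 1) * reflFun N m k
      = reflFun N m (k + 1) * reflFun N m k * reflFun N m (k + 1) := by
  have h01 : pos m k ≠ pos m (k + 1) := pos_ne (by omega) (by omega) (by omega)
  have h02 : pos m k ≠ pos m (k + 1 + 1) := pos_ne (by omega) (by omega) (by omega)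
  have h12 : pos m (k + 1) ≠ pos m (k + 1 + 1) := pos_ne (by omega) (by omega) (by omega)
  simp only [reflFun, funOp_mul]
  refine funOp_congr (fun z => ?_) fun z => ?_
  · ext x
    simp only [Function.comp_apply, Equiv.swap_apply_def]
    grind
  · rw [braidOp_yangBaxter h01 h02 h12]
    · congr 2
      · congr 1
        simp only [Function.comp_apply, Equiv.swap_apply_def]
        grind
      · simp only [Function.comp_apply, Equiv.swap_apply_def]
        grind
      · simp only [Function.comp_apply, Equiv.swap_apply_def]
        grind
    · simp only [Function.comp_apply, Equiv.swap_apply_def]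
      grind

lemma reflFun_far {k l : ℕ} (hkl : k + 2 ≤ l) (hl : l < m) :
    reflFun N m k * reflFun N m l = reflFun N m l * reflFun N m k := by
  have h1 : pos m k ≠ pos m l := pos_ne (by omega) (by omega) (by omega)
  have h2 : pos m k ≠ pos m (l + 1) := pos_ne (by omega) (by omega) (by omega)
  have h3 : pos m (k + 1) ≠ pos m l := pos_ne (by omega) (by omega) (by omega)
  have h4 : pos m (k + 1) ≠ pos m (l + 1) := pos_ne (by omega) (by omega) (by omega)
  simp only [reflFun, funOp_mul]
  refine funOp_congr (fun z => ?_) fun z => ?_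
  · ext x
    simp only [Function.comp_apply, Equiv.swap_apply_def]
    grind
  · rw [(braidOp_far h1 h2 h3 h4 _ _).eq]
    congr 2 <;> simp only [Function.comp_apply, Equiv.swap_apply_def] <;> grind

lemma rotFun_mul_reflFun (κ : ℂ) (p : Fin N → ℂ) {k : ℕ} (hk : k + 1 < m) :
    rotFun κ p * reflFun N m k = reflFun N m (k + 1) * rotFun κ p := by
  have h1 := finRotate_pos (m := m) (k := k) (by omega)
  have h2 := finRotate_pos (m := m) (k := k + 1) (by omega)
  have h3 := pos_ne_last (m := m) (k := k) (by omega)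
  have h4 := pos_ne_last (m := m) (k := k + 1) (by omega)
  rw [rotFun, reflFun, reflFun, funOp_mul, funOp_mul]
  refine funOp_congr (fun z => ?_) fun z => ?_
  · ext x
    have e : Equiv.swap (pos m (k + 1)) (pos m (k + 1 + 1)) (finRotate (m + 1) x)
        = finRotate (m + 1) (Equiv.swap (pos m k) (pos m (k + 1)) x) := by
      rw [← h2, ← h1, ← Equiv.Perm.mul_apply, ← Equiv.mul_swap_eq_swap_mul, h1,
        Equiv.Perm.mul_apply]
    have e' : Equiv.swap (pos m k) (pos m (k + 1)) x = Fin.last m ↔ x = Fin.last m := by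
      rw [Equiv.swap_apply_eq_iff, Equiv.swap_apply_of_ne_of_ne h3.symm h4.symm]
    simp only [rotArg, Function.comp_apply, e, e']
  · have e1 : finRotate (m + 1) (pos m k) ≠ 0 := by
      rw [h1, ← pos_zero]; exact pos_ne (by omega) (by omega) (by omega)
    have e2 : finRotate (m + 1) (pos m (k + 1)) ≠ 0 := by
      rw [h2, ← pos_zero]; exact pos_ne (by omega) (by omega) (by omega)
    rw [rotOp_mul_braidOp p e1 e2]
    simp only [rotArg, h1, h2, if_neg h3, if_neg h4, sub_zero]

/-- After two rotations both variables of the last pair are shifted by κ, so their difference is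
not. -/
lemma rotFun_mul_rotFun_mul_reflFun (κ : ℂ) (p : Fin N → ℂ) {k : ℕ} (hk : k + 1 = m) :
    rotFun κ p * rotFun κ p * reflFun N m k = reflFun N m 0 * (rotFun κ p * rotFun κ p) := by
  subst hk
  have h1 := finRotate_pos (m := k + 1) (k := k) (by omega)
  have h2 := finRotate_pos_last (m := k + 1)
  have h3 := pos_ne_last (m := k + 1) (k := k) (by omega)
  have h4 := pos_ne_last (m := k + 1) (k := 0) (by omega)
  have h5 := finRotate_pos (m := k + 1) (k := 0) (by omega)
  have h6 := pos_last (m := k + 1)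
  have h7 : pos (k + 1) k ≠ pos (k + 1) (k + 1) := h6 ▸ h3
  simp only [rotFun, reflFun, funOp_mul]
  refine funOp_congr (fun z => ?_) fun z => ?_
  · ext x
    have e : Equiv.swap (pos (k + 1) 0) (pos (k + 1) (0 + 1))
          (finRotate (k + 1 + 1) (finRotate (k + 1 + 1) x))
        = finRotate (k + 1 + 1) (finRotate (k + 1 + 1)
          (Equiv.swap (pos (k + 1) k) (pos (k + 1) (k + 1)) x)) := by
      have e1 := Equiv.mul_swap_eq_swap_mul (finRotate (k + 1 + 1) * finRotate (k + 1 + 1))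
        (pos (k + 1) k) (pos (k + 1) (k + 1))
      rw [Equiv.Perm.mul_apply, Equiv.Perm.mul_apply, h1, h2, h5,
        Equiv.swap_comm (pos (k + 1) 0)] at e1
      have := Equiv.congr_fun e1 x
      simp only [Equiv.Perm.mul_apply] at this
      rw [this, Equiv.swap_comm (pos (k + 1) 0)]
    have e' : ∀ x, finRotate (k + 1 + 1) x = pos (k + 1) (k + 1) ↔ x = pos (k + 1) k := by
      intro x
      rw [← h1]
      exact (finRotate (k + 1 + 1)).injective.eq_iff
    simp only [rotArg, Function.comp_apply, e, ← h6, e', Equiv.swap_apply_eq_iff,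
      Equiv.swap_apply_left, Equiv.swap_apply_right]
    ring
  · rw [rotOp_mul_rotOp_mul_braidOp p h6 (by rw [pos_val (by omega), pos_val le_rfl]), h1, h2, h5]
    have e : rotArg κ (rotArg κ z) (pos (k + 1) (k + 1)) - rotArg κ (rotArg κ z) (pos (k + 1) k)
        = z (pos (k + 1) (0 + 1)) - z (pos (k + 1) 0) := by
      simp only [rotArg, h1, h2, h5, ← h6, if_neg h7, if_neg (h6 ▸ h4), if_true]
      ring
    rw [e]

lemma comp_cycUpTo_symm_apply (z : Fin (m + 1) → ℂ) {k j : ℕ} (hkj : k < j) (hj : j ≤ m) :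
    (z ∘ (cycUpTo m k).symm) (pos m j) = z (pos m j) := by
  rw [Function.comp_apply]
  congr 1
  rw [Equiv.symm_apply_eq]
  ext
  rw [cycUpTo_apply (by omega), pos_val hj]
  split_ifs <;> omega

lemma comp_cycUpTo_symm_zero (z : Fin (m + 1) → ℂ) {k : ℕ} (hk : k ≤ m) :
    (z ∘ (cycUpTo m k).symm) 0 = z (pos m k) := by
  rw [Function.comp_apply]
  congr 1
  rw [Equiv.symm_apply_eq]
  ext
  rw [cycUpTo_apply hk, pos_val hk]
  simp

lemma downProd_reflFun {k : ℕ} (hk : k ≤ m) :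
    downProd (reflFun N m) k = funOp (fun z => z ∘ (cycUpTo m k).symm)
      fun z => braidProd (z ∘ (cycUpTo m k).symm) k := by
  induction k with
  | zero => exact funOp_one.symm
  | succ k ih =>
    rw [downProd, ih (by omega), reflFun, funOp_mul]
    have e : ∀ z : Fin (m + 1) → ℂ, (z ∘ Equiv.swap (pos m k) (pos m (k + 1))) ∘ (cycUpTo m k).symm
        = z ∘ (cycUpTo m (k + 1)).symm := fun z => rfl
    refine funOp_congr e fun z => ?_
    have h1 := comp_cycUpTo_symm_zero z hk
    have h2 := comp_cycUpTo_symm_apply (z ∘ Equiv.swap (pos m k) (pos m (k + 1))) (lt_add_one k) hk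
    have h3 : (z ∘ Equiv.swap (pos m k) (pos m (k + 1))) (pos m (k + 1)) = z (pos m k) := by simp
    rw [e, h3] at h2
    rw [e, braidProd, h1, h2]

lemma qkzFun_zero (κ : ℂ) (p : Fin N → ℂ) :
    qkzFun κ p 0 = rotFun κ p * downProd (reflFun N m) m := by
  rw [downProd_reflFun le_rfl, rotFun, funOp_mul, qkzFun]
  have e : ∀ z : Fin (m + 1) → ℂ, rotArg κ z ∘ (cycUpTo m m).symm = shift (-κ) 0 z := by
    intro z
    ext x
    have h : (finRotate (m + 1)).symm x = Fin.last m ↔ x = 0 := by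
      rw [Equiv.symm_apply_eq, finRotate_last]
    rw [cycUpTo_eq_finRotate]
    simp only [Function.comp_apply, rotArg, Equiv.apply_symm_apply, h, shift,
      Function.update_apply]
    split_ifs with h0
    · rw [h0]; ring
    · ring
  refine funOp_congr (fun z => (e z).symm) fun z => ?_
  rw [Klim_zero, e]

lemma shift_comp_swap (κ : ℂ) (a a' : Fin n) (z : Fin n → ℂ) :
    shift κ a' z ∘ Equiv.swap a a' = shift κ a (z ∘ Equiv.swap a a') := by
  ext x
  simp only [shift, Function.comp_apply, Function.update_apply, Equiv.swap_apply_eq_iff,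
    Equiv.swap_apply_right, Equiv.swap_apply_left]

lemma qkzFun_succ (κ : ℂ) (p : Fin N → ℂ) {k : ℕ} (hk : k < m) :
    qkzFun κ p (pos m (k + 1)) = reflFun N m k * qkzFun κ p (pos m k) * reflFun N m k := by
  have hne : pos m k ≠ pos m (k + 1) := pos_ne hk.le hk (by omega)
  rw [reflFun, qkzFun, qkzFun, funOp_mul, funOp_mul]
  refine funOp_congr (fun z => ?_) fun z => ?_
  · rw [← shift_comp_swap, Function.comp_assoc, ← Equiv.Perm.coe_mul, Equiv.swap_mul_self]
    rfl
  · rw [Klim_succ κ (by rw [pos_val hk.le, pos_val hk]), ← shift_comp_swap]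
    congr 2
    -- The κ in `Klim_succ` is absorbed by the shift of z_{a'} by -κ.
    · congr 2
      simp only [shift, Function.update_self, Function.update_of_ne hne]
      ring
    · simp only [shift, Function.comp_apply, Function.update_self, Function.update_of_ne hne,
        Equiv.swap_apply_left, Equiv.swap_apply_right]

/-- The qKZ difference operators commute. -/
lemma qkzFun_commute (κ : ℂ) (p : Fin N → ℂ) (a b : Fin n) :
    Commute (qkzFun κ p a) (qkzFun κ p b) := by
  rcases n with _ | m
  · exact a.elim0
  · have h := commute_translations (m := m) (s := reflFun N m) (c := rotFun κ p)
      (Z := fun k => qkzFun κ p (pos m k)) (fun k hk => reflFun_mul_self hk)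
      (fun k hk => reflFun_braid hk) (fun k l hkl hl => reflFun_far hkl hl)
      (fun k hk => rotFun_mul_reflFun κ p hk) (fun k hk => rotFun_mul_rotFun_mul_reflFun κ p hk)
      (qkzFun_zero κ p) (fun k hk => qkzFun_succ κ p hk)
      (Nat.lt_succ_iff.1 a.2) (Nat.lt_succ_iff.1 b.2)
    simpa only [pos_coe] using h

lemma dynFun_commute_reflFun (i : Fin N) (p : Fin N → ℂ) {k : ℕ} (hk : k < m) :
    Commute (dynFun i p) (reflFun N m k) := by
  rw [Commute, SemiconjBy, dynFun, reflFun, funOp_mul, funOp_mul]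
  refine funOp_congr (fun z => rfl) fun z => ?_
  have h := braidOp_mul_Xlim i (z ∘ Equiv.swap (pos m k) (pos m (k + 1))) p
    (a := pos m k) (a' := pos m (k + 1)) (by rw [pos_val hk.le, pos_val hk])
  rw [Function.comp_assoc, ← Equiv.Perm.coe_mul, Equiv.swap_mul_self] at h
  simpa using h.symm

lemma rotOp_mul_eOp (p : Fin N → ℂ) (b : Fin (m + 1)) (i : Fin N) :
    rotOp p * eOp b i = eOp (finRotate (m + 1) b) i * rotOp p := by
  rw [rotOp, eOp, eOp, mono_mul_mono, mono_mul_mono, one_mul, mul_one]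
  exact mono_congr _ fun J => mul_comm _ _

lemma eOp_zero_mul_rotOp (i : Fin N) (p : Fin N → ℂ) :
    eOp 0 i * rotOp p = (rotOp (Pi.single i (p i)) : TOp N (m + 1)) := by
  rw [rotOp, eOp, mono_mul_mono, one_mul, rotOp]
  refine mono_congr _ fun J => ?_
  simp only [Function.comp_apply, Equiv.Perm.coe_one, id_eq, Pi.single_apply]
  split_ifs with h
  · rw [h, one_mul]
  · rw [zero_mul]

/-- The exchange part commutes with the rotation. The diagonal part fails to by the shift of the
variable that returns to the first place, which gives κ e_i^{(1)} times the rotation, the same as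
keeping only the i-th entry of p. -/
lemma dynFun_rotFun (κ : ℂ) (i : Fin N) {p : Fin N → ℂ} (hp : p ∈ pDomain N) :
    dynFun i p * rotFun (m := m) κ p - rotFun κ p * dynFun i p
      = κ • rotFun κ (Pi.single i (p i)) := by
  have hX : ∀ z : Fin (m + 1) → ℂ, Xlim i z p * rotOp p - rotOp p * Xlim i (rotArg κ z) p
      = κ • rotOp (Pi.single i (p i)) := by
    intro z
    have h1 := (rotOp_commute_exchSum (m := m) i hp).eq
    have h2 : rotOp p * diagSum i (rotArg κ z) = (diagSum i z - κ • eOp 0 i) * rotOp p := by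
      have e : κ • eOp 0 i
          = ∑ a : Fin (m + 1), (if a = 0 then κ else 0) • (eOp a i : TOp N (m + 1)) := by
        simp
      rw [e, diagSum, diagSum, ← Finset.sum_sub_distrib, Finset.mul_sum, Finset.sum_mul]
      refine Fintype.sum_equiv (finRotate (m + 1)) _ _ fun b => ?_
      have h : finRotate (m + 1) b = 0 ↔ b = Fin.last m := by
        rw [← finRotate_last]
        exact (finRotate (m + 1)).injective.eq_iff
      rw [mul_smul_comm, rotOp_mul_eOp, ← sub_smul, smul_mul_assoc, rotArg]
      simp only [h]
    rw [Xlim_eq, Xlim_eq, mul_add, h2, h1, ← eOp_zero_mul_rotOp]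
    simp only [add_mul, sub_mul, smul_mul_assoc]
    abel
  refine LinearMap.ext fun f => funext fun z => ?_
  rw [LinearMap.sub_apply, Pi.sub_apply, LinearMap.smul_apply, Pi.smul_apply, dynFun, rotFun,
    funOp_mul, funOp_mul, rotFun, funOp_apply, funOp_apply, funOp_apply, ← Matrix.sub_mulVec, hX,
    Matrix.smul_mulVec]

/-- The commutator of the dynamical and the qKZ operators on functions of `z`. -/
lemma dynFun_qkzFun (κ : ℂ) (i : Fin N) {p : Fin N → ℂ} (hp : p ∈ pDomain N) (a : Fin n) :
    dynFun i p * qkzFun κ p a - qkzFun κ p a * dynFun i p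
      = κ • qkzFun κ (Pi.single i (p i)) a := by
  rcases n with _ | m
  · exact a.elim0
  have hd : ∀ k ≤ m, Commute (dynFun i p) (downProd (reflFun N m) k) := by
    intro k hk
    induction k with
    | zero => exact Commute.one_right _
    | succ k ih => exact (dynFun_commute_reflFun i p hk).mul_right (ih (by omega))
  have key : ∀ k ≤ m, dynFun i p * qkzFun κ p (pos m k) - qkzFun κ p (pos m k) * dynFun i p
      = κ • qkzFun κ (Pi.single i (p i)) (pos m k) := by
    intro k hk
    induction k with
    | zero =>
      have h := dynFun_rotFun (m := m) κ i hp
      have h2 := (hd m le_rfl).eq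
      rw [pos_zero, qkzFun_zero, qkzFun_zero, ← smul_mul_assoc, ← h, sub_mul,
        mul_assoc _ (downProd _ _),
        ← h2]
      simp only [mul_assoc]
    | succ k ih =>
      have h := (dynFun_commute_reflFun (m := m) i p hk).eq
      rw [qkzFun_succ κ _ hk, qkzFun_succ κ _ hk, ← smul_mul_assoc, ← mul_smul_comm,
        ← ih (by omega), mul_sub, sub_mul]
      generalize reflFun N m k = s at *
      generalize dynFun i p = x at *
      generalize qkzFun κ p (pos m k) = Y at *
      congr 1
      · rw [← mul_assoc x, ← mul_assoc x, h]
        simp only [mul_assoc]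
      · rw [mul_assoc _ s x, ← h]
        simp only [mul_assoc]
  have := key a (Nat.lt_succ_iff.1 a.2)
  rwa [pos_coe] at this

end Difference

/-! ### Derivatives in the parameters `p` -/

section Derivatives

variable {N n : ℕ}

/-- All entries of `A` are differentiable at `p`, and `A'` is the derivative. -/
def HasEntryDeriv (A : (Fin N → ℂ) → TOp N n) (A' : (Fin N → ℂ) → TOp N n) (p : Fin N → ℂ) : Prop :=
  ∀ J I, ∃ L : (Fin N → ℂ) →L[ℂ] ℂ, HasFDerivAt (fun q => A q J I) L p ∧ ∀ v, L v = A' v J I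

lemma hasEntryDeriv_const (A : TOp N n) (p : Fin N → ℂ) :
    HasEntryDeriv (fun _ => A) (fun _ => 0) p :=
  fun _ _ => ⟨0, hasFDerivAt_const _ _, fun _ => rfl⟩

lemma HasEntryDeriv.add {A B A' B' : (Fin N → ℂ) → TOp N n} {p : Fin N → ℂ}
    (hA : HasEntryDeriv A A' p) (hB : HasEntryDeriv B B' p) :
    HasEntryDeriv (fun q => A q + B q) (fun v => A' v + B' v) p := by
  intro J I
  obtain ⟨L, hL, hL'⟩ := hA J I
  obtain ⟨M, hM, hM'⟩ := hB J I
  exact ⟨L + M, hL.add hM, fun v => by rw [add_apply, hL', hM']; rfl⟩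

lemma HasEntryDeriv.neg {A A' : (Fin N → ℂ) → TOp N n} {p : Fin N → ℂ}
    (hA : HasEntryDeriv A A' p) : HasEntryDeriv (fun q => -A q) (fun v => -A' v) p := by
  intro J I
  obtain ⟨L, hL, hL'⟩ := hA J I
  exact ⟨-L, hL.neg, fun v => by rw [neg_apply, hL']; rfl⟩

lemma HasEntryDeriv.sum {ι : Type*} {s : Finset ι} {A A' : ι → (Fin N → ℂ) → TOp N n}
    {p : Fin N → ℂ} (h : ∀ x ∈ s, HasEntryDeriv (A x) (A' x) p) :
    HasEntryDeriv (fun q => ∑ x ∈ s, A x q) (fun v => ∑ x ∈ s, A' x v) p := by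
  classical
  induction s using Finset.induction_on with
  | empty => simpa using hasEntryDeriv_const 0 p
  | insert x s hx ih =>
    simp only [Finset.sum_insert hx]
    exact (h x (by simp)).add (ih fun y hy => h y (by simp [hy]))

lemma hasEntryDeriv_smul {r : (Fin N → ℂ) → ℂ} {L : (Fin N → ℂ) →L[ℂ] ℂ} {p : Fin N → ℂ}
    (hr : HasFDerivAt r L p) (M : TOp N n) :
    HasEntryDeriv (fun q => r q • M) (fun v => L v • M) p := by
  intro J I
  refine ⟨(M J I) • L, ?_, fun v => ?_⟩
  · simpa using hr.mul_const (M J I)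
  · simp [mul_comm]

lemma HasEntryDeriv.mulVec {A A' : (Fin N → ℂ) → TOp N n} {p : Fin N → ℂ}
    (hA : HasEntryDeriv A A' p) {g : (Fin N → ℂ) → TSpace N n} (hg : DifferentiableAt ℂ g p) :
    DifferentiableAt ℂ (fun q => A q *ᵥ g q) p ∧ ∀ v, fderiv ℂ (fun q => A q *ᵥ g q) p v
      = A' v *ᵥ g p + A p *ᵥ fderiv ℂ g p v := by
  choose L hL hL' using hA
  have hgI : ∀ I, HasFDerivAt (fun q => g q I)
      ((ContinuousLinearMap.proj I).comp (fderiv ℂ g p)) p :=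
    hasFDerivAt_pi'.1 hg.hasFDerivAt
  have h : HasFDerivAt (fun q => A q *ᵥ g q) (ContinuousLinearMap.pi fun J =>
      ∑ I, (A p J I • (ContinuousLinearMap.proj I).comp (fderiv ℂ g p) + g p I • L J I)) p := by
    refine hasFDerivAt_pi.2 fun J => ?_
    have := HasFDerivAt.fun_sum (u := Finset.univ) fun I _ => (hL J I).mul (hgI I)
    exact this
  refine ⟨h.differentiableAt, fun v => ?_⟩
  rw [h.fderiv]
  ext J
  simp only [ContinuousLinearMap.coe_pi', sum_apply, add_apply, smul_apply,
    ContinuousLinearMap.comp_apply,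
    ContinuousLinearMap.proj_apply, hL', Pi.add_apply, Matrix.mulVec, dotProduct, smul_eq_mul,
    ← Finset.sum_add_distrib]
  exact Finset.sum_congr rfl fun I _ => by ring

lemma hasFDerivAt_ratio (i j : Fin N) {p : Fin N → ℂ} (hp : p i ≠ 0) :
    ∃ L : (Fin N → ℂ) →L[ℂ] ℂ, HasFDerivAt (fun q : Fin N → ℂ => q j / q i) L p ∧
      ∀ v, L v = v j / p i - p j / p i ^ 2 * v i := by
  have hj := hasFDerivAt_apply (𝕜 := ℂ) j p
  have hi := (hasDerivAt_inv hp).comp_hasFDerivAt p (hasFDerivAt_apply (𝕜 := ℂ) i p)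
  refine ⟨_, hj.mul hi, fun v => ?_⟩
  simp
  field_simp
  ring

/-- The part of the exchange operator that carries the quantum parameter. -/
def wrapExch (i j : Fin N) (p : Fin N → ℂ) : TOp N n :=
  ∑ x : Fin n × Fin n, (if x.1 < x.2 then 0 else p j / p i) • hop i j x.1 x.2

/-- Only the hops across the end depend on p, through p_j/p_i, an eigenfunction of each p_l ∂/∂p_l
with eigenvalue δ_{lj} - δ_{li}. -/
lemma hasEntryDeriv_exchOp (i j : Fin N) {p : Fin N → ℂ} (hp : p ∈ pDomain N) :
    ∃ A', HasEntryDeriv (exchOp (n := n) i j) A' p ∧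
      ∀ l, p l • A' (Pi.single l 1)
        = ((if l = j then 1 else 0) - (if l = i then 1 else 0) : ℂ) • wrapExch i j p := by
  obtain ⟨L, hL, hL'⟩ := hasFDerivAt_ratio i j (hp i)
  refine ⟨fun v => ∑ x : Fin n × Fin n, (if x.1 < x.2 then 0 else L v) • hop i j x.1 x.2,
    HasEntryDeriv.sum fun x _ => ?_, fun l => ?_⟩
  · by_cases hx : x.1 < x.2
    · simpa [wrapWeight, hx] using hasEntryDeriv_const (hop i j x.1 x.2) p
    · simpa [wrapWeight, hx] using hasEntryDeriv_smul hL (hop i j x.1 x.2)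
  · rw [wrapExch, Finset.smul_sum, Finset.smul_sum]
    refine Finset.sum_congr rfl fun x _ => ?_
    rw [smul_smul, smul_smul]
    congr 1
    rw [mul_ite, mul_ite, mul_zero, mul_zero, hL']
    have hpi := hp i
    congr 1
    by_cases h1 : l = j <;> by_cases h2 : l = i
    · subst h1; subst h2
      simp
      field_simp
      simp
    · subst h1
      simp [Ne.symm h2, h2]
      field_simp
    · subst h2
      simp [Ne.symm h1, h1]
      field_simp
    · simp [Ne.symm h1, Ne.symm h2, h1, h2]

/-- The symmetric version of `wrapExch`. -/
def symmWrapExch (i j : Fin N) (p : Fin N → ℂ) : TOp N n :=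
  if i < j then wrapExch i j p else if j < i then wrapExch j i p else 0

lemma symmWrapExch_comm (i j : Fin N) (p : Fin N → ℂ) :
    symmWrapExch (n := n) i j p = symmWrapExch j i p := by
  unfold symmWrapExch
  rcases lt_trichotomy i j with h | rfl | h
  · simp [h, h.not_gt]
  · rfl
  · simp [h, h.not_gt]

lemma hasEntryDeriv_signedExch (i j : Fin N) {p : Fin N → ℂ} (hp : p ∈ pDomain N) :
    ∃ A', HasEntryDeriv (signedExch (n := n) i j) A' p ∧
      ∀ l, p l • A' (Pi.single l 1)
        = ((if l = j then 1 else 0) - (if l = i then 1 else 0) : ℂ) • symmWrapExch i j p := by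
  unfold signedExch symmWrapExch
  rcases lt_trichotomy i j with h | rfl | h
  · simp only [if_pos h]
    exact hasEntryDeriv_exchOp i j hp
  · simp only [lt_irrefl, if_false]
    exact ⟨fun _ => 0, hasEntryDeriv_const 0 p, fun l => by simp⟩
  · simp only [if_neg h.not_gt, if_pos h]
    obtain ⟨A', hA, hA'⟩ := hasEntryDeriv_exchOp (n := n) j i hp
    exact ⟨fun v => -A' v, hA.neg, fun l => by rw [smul_neg, hA', ← neg_smul, neg_sub]⟩

/-- The derivative is symmetric in `i` and `l` by `symmWrapExch_comm`: this is the part of the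
flatness condition of first order in κ. -/
lemma hasEntryDeriv_Xlim (i : Fin N) (z : Fin n → ℂ) {p : Fin N → ℂ} (hp : p ∈ pDomain N) :
    ∃ A', HasEntryDeriv (Xlim i z) A' p ∧
      ∀ l, l ≠ i → p l • A' (Pi.single l 1) = symmWrapExch i l p := by
  choose A' hA hA' using fun j => hasEntryDeriv_signedExch (n := n) i j hp
  have hX : Xlim i z = fun p => diagSum i z + exchSum i p := funext fun p => Xlim_eq i z p
  refine ⟨fun v => 0 + ∑ j, A' j v, ?_, fun l hl => ?_⟩
  · rw [hX]
    exact (hasEntryDeriv_const _ p).add (HasEntryDeriv.sum fun j _ => hA j)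
  · simp only [zero_add, Finset.smul_sum, hA', if_neg hl, sub_zero, ite_smul, one_smul, zero_smul]
    simp

lemma Klim_add (κ : ℂ) (a : Fin n) (w : Fin n → ℂ) (p q : Fin N → ℂ) :
    Klim κ a w (p + q) = Klim κ a w p + Klim κ a w q := by
  have h : pPow a (p + q) = (pPow a p + pPow a q : TOp N n) := by
    rw [pPow_eq, pPow_eq, pPow_eq, mono_add]; rfl
  rw [Klim, Klim, Klim, h, mul_add, add_mul]

lemma Klim_smul (κ : ℂ) (a : Fin n) (w : Fin n → ℂ) (r : ℂ) (p : Fin N → ℂ) :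
    Klim κ a w (r • p) = r • Klim κ a w p := by
  have h : pPow a (r • p) = (r • pPow a p : TOp N n) := by
    rw [pPow_eq, pPow_eq, smul_mono]; rfl
  rw [Klim, Klim, h, mul_smul_comm, smul_mul_assoc]

lemma hasEntryDeriv_Klim (κ : ℂ) (a : Fin n) (w : Fin n → ℂ) (p : Fin N → ℂ) :
    HasEntryDeriv (Klim κ a w) (Klim κ a w) p := by
  intro J I
  let L : (Fin N → ℂ) →ₗ[ℂ] ℂ :=
    { toFun := fun q => Klim κ a w q J I
      map_add' := fun q q' => by rw [Klim_add]; rfl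
      map_smul' := fun r q => by rw [Klim_smul]; rfl }
  exact ⟨LinearMap.toContinuousLinearMap L,
    (LinearMap.toContinuousLinearMap L).hasFDerivAt, fun v => rfl⟩

end Derivatives

/-! ### Compatibility -/

section Compatibility

variable {N n : ℕ}

lemma qkzOp_commute (κ : ℂ) (a b : Fin n) (f : TFun N n) (z : Fin n → ℂ) (p : Fin N → ℂ) :
    qkzOp κ a (qkzOp κ b f) z p = qkzOp κ b (qkzOp κ a f) z p :=
  congrFun (LinearMap.congr_fun (qkzFun_commute κ p a b).eq fun z => f z p) z

lemma Klim_flat (κ : ℂ) (p : Fin N → ℂ) :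
    IsDiscreteFlatConnection (n := n) κ fun a z => Klim κ a z p := by
  intro a b z
  by_cases hab : a = b
  · rw [hab]
  have key : ∀ v : TSpace N n, (Klim κ a (shift κ b z) p * Klim κ b z p) *ᵥ v
      = (Klim κ b (shift κ a z) p * Klim κ a z p) *ᵥ v := by
    intro v
    -- Constant functions suffice. Evaluating at the point shifted forward in both variables undoes
    -- the backward shifts in the difference operators.
    have h := congrFun (LinearMap.congr_fun (qkzFun_commute κ p a b).eq fun _ => v)
      (shift κ a (shift κ b z))
    simp only [qkzFun, funOp_mul, funOp_apply] at h
    have h1 : ∀ (a : Fin n) (w : Fin n → ℂ), shift (-κ) a (shift κ a w) = w := by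
      intro a w
      simp [shift]
    have h2 : shift κ a (shift κ b z) = shift κ b (shift κ a z) := by
      unfold shift
      rw [Function.update_of_ne hab, Function.update_of_ne (Ne.symm hab), Function.update_comm hab]
    rw [h1, h1, h2, h1, h1] at h
    exact h
  exact Matrix.ext_of_mulVec_single fun i => key _

lemma Xlim_mul_Klim (κ : ℂ) (i : Fin N) (a : Fin n) (z : Fin n → ℂ) {p : Fin N → ℂ}
    (hp : p ∈ pDomain N) (v : TSpace N n) :
    Xlim i z p *ᵥ (Klim κ a (shift (-κ) a z) p *ᵥ v)
      - Klim κ a (shift (-κ) a z) p *ᵥ (Xlim i (shift (-κ) a z) p *ᵥ v)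
      = (κ * p i) • (Klim κ a (shift (-κ) a z) (Pi.single i 1) *ᵥ v) := by
  have h := congrFun (LinearMap.congr_fun (dynFun_qkzFun κ i hp a) fun _ => v) z
  have h2 : (Pi.single i (p i) : Fin N → ℂ) = p i • Pi.single i 1 := by
    rw [← Pi.single_smul, smul_eq_mul, mul_one]
  rw [h2] at h
  simp only [dynFun, qkzFun, funOp_mul, LinearMap.sub_apply, Pi.sub_apply, funOp_apply,
    LinearMap.smul_apply, Pi.smul_apply, Klim_smul, Matrix.smul_mulVec, smul_smul,
    ← Matrix.mulVec_mulVec] at h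
  exact h

/-- By the product rule the derivative of K° contributes κ p_i K°(e_i), with e_i the i-th unit
vector in place of p; `Xlim_mul_Klim` identifies it with the commutator of X° and K°. -/
lemma nablaLim_qkzOp (κ : ℂ) (i : Fin N) (a : Fin n) :
    CommuteOnSections (nablaLim (N := N) κ i) (qkzOp κ a) := by
  intro U _ hUp f hf z p hp
  have hK := (hasEntryDeriv_Klim κ a (shift (-κ) a z) p).mulVec
    (hf (shift (-κ) a z) p hp).differentiableAt
  have h := Xlim_mul_Klim κ i a z (hUp hp) (f (shift (-κ) a z) p)
  have hd := hK.2 (Pi.single i 1)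
  change (κ * p i) • fderiv ℂ (fun q => Klim κ a (shift (-κ) a z) q *ᵥ f (shift (-κ) a z) q) p
    (Pi.single i 1) - Xlim i z p *ᵥ (Klim κ a (shift (-κ) a z) p *ᵥ f (shift (-κ) a z) p)
    = Klim κ a (shift (-κ) a z) p *ᵥ ((κ * p i) • fderiv ℂ (f (shift (-κ) a z)) p (Pi.single i 1)
      - Xlim i (shift (-κ) a z) p *ᵥ f (shift (-κ) a z) p)
  rw [hd, Matrix.mulVec_sub, smul_add, ← h, Matrix.mulVec_smul]
  abel

/-- An expansion whose terms are each symmetric in `i`, `k`, or are exchanged in pairs, once second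
derivatives and the X°'s are known to commute. -/
lemma nablaLim_nablaLim_apply (κ : ℂ) (i k : Fin N) {U : Set (Fin N → ℂ)} (hUp : U ⊆ pDomain N)
    {f : TFun N n} (hf : HolomorphicIn U f) (z : Fin n → ℂ) {p : Fin N → ℂ} (hp : p ∈ U)
    (hik : i ≠ k) :
    nablaLim κ i (nablaLim κ k f) z p
      = (κ * p i) • (κ * p k) • fderiv ℂ (fderiv ℂ (f z)) p (Pi.single i 1) (Pi.single k 1)
        - κ • (symmWrapExch k i p *ᵥ f z p)
        - (κ * p i) • (Xlim k z p *ᵥ fderiv ℂ (f z) p (Pi.single i 1))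
        - (κ * p k) • (Xlim i z p *ᵥ fderiv ℂ (f z) p (Pi.single k 1))
        + (Xlim i z p * Xlim k z p) *ᵥ f z p := by
  obtain ⟨A', hA, hA'⟩ := hasEntryDeriv_Xlim (n := n) k z (hUp hp)
  have hfp := hf z p hp
  have hX := hA.mulVec hfp.differentiableAt
  have hdd : DifferentiableAt ℂ (fderiv ℂ (f z)) p := hfp.fderiv.differentiableAt
  have hd1 : HasFDerivAt (fun q => fderiv ℂ (f z) q (Pi.single k 1))
      ((fderiv ℂ (fderiv ℂ (f z)) p).flip (Pi.single k 1)) p := by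
    simpa using hdd.hasFDerivAt.clm_apply (hasFDerivAt_const (Pi.single k (1 : ℂ)) p)
  have hc : HasFDerivAt (fun q : Fin N → ℂ => κ * q k)
      (κ • ContinuousLinearMap.proj (R := ℂ) (φ := fun _ : Fin N => ℂ) k) p :=
    (hasFDerivAt_apply (𝕜 := ℂ) k p).const_mul κ
  have hg := (hc.smul hd1).sub hX.1.hasFDerivAt
  have hd : fderiv ℂ (nablaLim κ k f z) p (Pi.single i 1)
      = (κ * p k) • fderiv ℂ (fderiv ℂ (f z)) p (Pi.single i 1) (Pi.single k 1)
        - (A' (Pi.single i 1) *ᵥ f z p + Xlim k z p *ᵥ fderiv ℂ (f z) p (Pi.single i 1)) := by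
    have e : nablaLim κ k f z = (fun q => (κ * q k) • fderiv ℂ (f z) q (Pi.single k 1))
      - fun q => Xlim k z q *ᵥ f z q := rfl
    rw [e]
    erw [hg.fderiv]
    simp [hX.2, hik.symm]
  have hs := hA' i hik
  rw [nablaLim, hd, nablaLim, Matrix.mulVec_sub, Matrix.mulVec_smul, Matrix.mulVec_mulVec, ← hs,
    Matrix.smul_mulVec]
  module

lemma nablaLim_commute (κ : ℂ) (i k : Fin N) :
    CommuteOnSections (nablaLim (n := n) κ i) (nablaLim κ k) := by
  intro U _ hUp f hf z p hp
  by_cases hik : i = k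
  · rw [hik]
  have hsymm : IsSymmSndFDerivAt ℂ (f z) p :=
    ContDiffAt.isSymmSndFDerivAt (n := 2) (hf z p hp).contDiffAt (by simp)
  rw [nablaLim_nablaLim_apply κ i k hUp hf z hp hik,
    nablaLim_nablaLim_apply κ k i hUp hf z hp (Ne.symm hik), symmWrapExch_comm k i,
    (Xlim_commute i k z (hUp hp)).eq, hsymm.eq (Pi.single i 1) (Pi.single k 1)]
  module

end Compatibility

end LimitQKZ

end
theorem theorem3 (N n : ℕ) (κ : ℂ) :
    LimitQKZ.JointSystemCompatible N n κ ∧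
    (∀ p : Fin N → ℂ, LimitQKZ.IsDiscreteFlatConnection (n := n) κ
      (fun a z => LimitQKZ.Klim κ a z p)) ∧
    (∀ i j : Fin N, LimitQKZ.CommuteOnSections
      (LimitQKZ.nablaLim (n := n) κ i) (LimitQKZ.nablaLim κ j)) := by
  exact ⟨⟨fun a b _ _ _ f _ z p _ => LimitQKZ.qkzOp_commute κ a b f z p,
    fun i j => LimitQKZ.nablaLim_commute κ i j, fun i a => LimitQKZ.nablaLim_qkzOp κ i a⟩,
    fun p => LimitQKZ.Klim_flat κ p, fun i j => LimitQKZ.nablaLim_commute κ i j⟩
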